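/- Let $P$ be a nonempty set of $n$ points on the line, given by their (distinct) integer coordinates in $\{0,\dots,U\}$, and let each point $p\in P$ have a color $\mathrm{col}(p)$. For a fixed parameter $\tau\ge 1$, a color $c$ \emph{$\tau$-dominates} an interval $Q=[a,b]$ with $P\cap Q\neq\emptyset$ if at least a $1/\tau$ fraction of the points in $Q$ have color $c$, that is, $\tau\cdot|\{p\in P\cap Q : \mathrm{col}(p)=c\}|\ \ge\ |P\cap Q|$. A \emph{$\tau$-domination query} asks, for a given interval $[a,b]$, to report all colors that $\tau$-dominate it, each exactly once (no color if $P\cap[a,b]=\emptyset$). \textbf{Theorem 2.} On the word RAM (unit-cost arithmetic, bitwise, shift, comparison and memory instructions on $w$-bit words, where $w$ is large enough for a word to hold a coordinate, a color, or an address of the memory that is used), there is a static data structure that uses $O(\tau n)$ words of space, including the work space of the queries, and answers every one-dimensional $\tau$-domination query in $O(\tau\,\log\log U\,\log\log n)$ time. The query algorithm and the constants in the $O$-bounds are independent of $w$, $U$, $\tau$, $n$, $P$ and the coloring; $\log\log x$ is read as $\max\{1,\log_2\log_2 x\}$ (and as $1$ for $x\le 2$). -/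

import Mathlib

/-! The word RAM: registers and memory cells hold words of `w` bits, every instruction has unit
cost, and a program is a finite list of instructions that does not depend on `w`. -/

namespace WordRAM

/-- The binary operations on words. -/
inductive Op where
  | add | sub | mul | div | mod | and | or | xor | shl | shr

/-- All operations are unsigned and modulo `2 ^ w`; shifts by `w` or more places give `0`. -/
def Op.eval {w : ℕ} : Op → BitVec w → BitVec w → BitVec w
  | .add, x, y => x + y
  | .sub, x, y => x - y
  | .mul, x, y => x * y
  | .div, x, y => x / y
  | .mod, x, y => x % y
  | .and, x, y => x &&& y
  | .or, x, y => x ||| y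
  | .xor, x, y => x ^^^ y
  | .shl, x, y => x <<< y.toNat
  | .shr, x, y => x >>> y.toNat

/-- Instructions. Natural numbers `r`, `x`, `y` are names of registers, `l` is a position in the
program. -/
inductive Instr where
  /-- `r := k` (modulo `2 ^ w`) -/
  | const (r k : ℕ)
  /-- `r := x` -/
  | move (r x : ℕ)
  /-- `r := x op y` -/
  | op (o : Op) (r x y : ℕ)
  /-- `r := Mem[x]` -/
  | load (r x : ℕ)
  /-- `Mem[x] := y` -/
  | store (x y : ℕ)
  /-- continue at position `l` -/
  | jump (l : ℕ)
  /-- continue at position `l` if `x = y` -/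
  | jumpEq (x y l : ℕ)
  /-- continue at position `l` if `x < y` (unsigned) -/
  | jumpLt (x y l : ℕ)
  /-- report the word in register `x` -/
  | output (x : ℕ)
  /-- stop -/
  | halt

/-- A configuration of the machine with words of `w` bits. -/
structure Config (w : ℕ) where
  pc : ℕ
  reg : ℕ → BitVec w
  mem : ℕ → BitVec w
  out : List (BitVec w)

/-- One step of the machine whose memory consists of the cells `0, …, s - 1`. There is no next
configuration if the machine has stopped, if it has left the program, or if it tries to access a
cell outside the memory. -/
def step {w : ℕ} (prog : List Instr) (s : ℕ) (σ : Config w) : Option (Config w) :=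
  match prog[σ.pc]? with
  | none => none
  | some (.const r k) =>
      some { σ with pc := σ.pc + 1, reg := Function.update σ.reg r (BitVec.ofNat w k) }
  | some (.move r x) =>
      some { σ with pc := σ.pc + 1, reg := Function.update σ.reg r (σ.reg x) }
  | some (.op o r x y) =>
      some { σ with pc := σ.pc + 1, reg := Function.update σ.reg r (o.eval (σ.reg x) (σ.reg y)) }
  | some (.load r x) =>
      if (σ.reg x).toNat < s then
        some { σ with pc := σ.pc + 1, reg := Function.update σ.reg r (σ.mem (σ.reg x).toNat) }
      else none
  | some (.store x y) =>
      if (σ.reg x).toNat < s then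
        some { σ with pc := σ.pc + 1, mem := Function.update σ.mem (σ.reg x).toNat (σ.reg y) }
      else none
  | some (.jump l) => some { σ with pc := l }
  | some (.jumpEq x y l) =>
      some { σ with pc := if σ.reg x = σ.reg y then l else σ.pc + 1 }
  | some (.jumpLt x y l) =>
      some { σ with pc := if (σ.reg x).toNat < (σ.reg y).toNat then l else σ.pc + 1 }
  | some (.output x) => some { σ with pc := σ.pc + 1, out := σ.out ++ [σ.reg x] }
  | some .halt => none

/-- The configuration after exactly `t` steps, if the machine gets that far. -/
def run {w : ℕ} (prog : List Instr) (s : ℕ) : ℕ → Config w → Option (Config w)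
  | 0, σ => some σ
  | t + 1, σ => (step prog s σ).bind (run prog s t)

/-- The machine has reached a `halt` instruction. -/
def Halted {w : ℕ} (prog : List Instr) (σ : Config w) : Prop :=
  prog[σ.pc]? = some Instr.halt

/-- The start of a query with the two arguments `a` and `b` on the memory `M`: the arguments are in
registers `0` and `1`, all other registers are `0`, and nothing has been reported. -/
def start {w : ℕ} (M : ℕ → BitVec w) (a b : BitVec w) : Config w where
  pc := 0
  reg := fun r => if r = 0 then a else if r = 1 then b else 0
  mem := M
  out := []

end WordRAM

/-- The points of `P` in the interval `[a, b]`. -/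
def pointsIn (P : Finset ℕ) (a b : ℕ) : Finset ℕ :=
  P.filter fun p => a ≤ p ∧ p ≤ b

/-- Color `c` `τ`-dominates `[a, b]`: the interval contains a point, and at least the fraction
`1 / τ` of the points in it have color `c`. -/
def TauDominates {Γ : Type} [DecidableEq Γ] (τ : ℝ) (P : Finset ℕ) (col : ℕ → Γ) (a b : ℕ)
    (c : Γ) : Prop :=
  (pointsIn P a b).Nonempty ∧
    ((pointsIn P a b).card : ℝ) ≤ τ * (((pointsIn P a b).filter fun p => col p = c).card : ℝ)

/-- `prog` answers all one-dimensional `τ`-domination queries on the colored point set `P` with a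
static data structure in a memory of `s` words of `w` bits, each query in at most `T` steps. The
data structure `D` occupies the first `k ≤ s` cells; the other cells are work space with arbitrary
contents. Every query leaves `D` as it was and reports each dominating color exactly once. -/
def SupportsDomination {w : ℕ} (prog : List WordRAM.Instr) (s : ℕ) (T : ℝ) (τ : ℝ)
    (P : Finset ℕ) (col : ℕ → BitVec w) : Prop :=
  ∃ k ≤ s, ∃ D : Fin k → BitVec w,
    ∀ M : ℕ → BitVec w, (∀ i : Fin k, M i = D i) →
      ∀ a b : BitVec w, ∃ (t : ℕ) (σ : WordRAM.Config w),
        (t : ℝ) ≤ T ∧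
        WordRAM.run prog s t (WordRAM.start M a b) = some σ ∧
        WordRAM.Halted prog σ ∧
        (∀ i : Fin k, σ.mem i = D i) ∧
        σ.out.Nodup ∧
        ∀ c : BitVec w, c ∈ σ.out ↔ TauDominates τ P col a.toNat b.toNat c

/-- `log log x` (base `2`), but at least `1`. -/
noncomputable def loglog (x : ℕ) : ℝ :=
  max 1 (Real.logb 2 (Real.logb 2 (x : ℝ)))

/-! Let an interval contain `m` points, put `k = log₂ m` (rounded down), and cut the ranks into
blocks of length `2 ^ k`. Since `m < 2 ^ (k + 1)`, the interval lies in a window of three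
consecutive blocks. A dominating color has at least `m / τ ≥ 2 ^ k / τ` points in that window, which
has at most `3 * 2 ^ k` points, so at most `3 * τ` colors qualify (`card_candidates_le`). Listing
these candidates for every window costs `O(τ * n / 2 ^ k)` words on level `k`, a geometric sum of
order `τ * n`. A query checks each candidate by counting its points in the interval
(`tauDominates_iff`), which takes two rank queries in the color class; the classes have `n` points
altogether.

A rank query in a set of `L`-bit numbers takes `O(log L)` steps and linear space. Only every `L`-th
element is sampled, and the `L` trie ancestors of the samples are kept in a dictionary. Binary
search over the heights finds a stored ancestor of `x` whose child towards `x` is not stored. No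
sample separates `x` from the middle of that ancestor, so the number of samples below the middle
fixes the rank of `x` up to `L` (`rank_bracket`). Binary search in the sorted array finishes the
query. The dictionary is two-level perfect hashing with multiply-shift functions (`placeable_dict`),
so a lookup takes constant time.

With `L = O(log U)` the query time is `O(τ * loglog U)`; the factor `loglog n ≥ 1` of the claim is
not needed. Thresholds `⌈m / τ⌉` and logarithms are tabulated, so the program does not depend on `τ`
and handles no real numbers.

To reach the actual machine, the query is written in a small structured language that never writes
to memory. `Stmt.run_code` shows that compilation preserves results and step counts, `Stmt.WP` is a
program logic with time bounds, and `Placeable` is a calculus for laying out linked records in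
memory. -/

/-! ### Lists in consecutive cells. -/

/-- The list `l` is stored in consecutive cells from `base` on. -/
def Stored {α : Type*} (f : ℕ → Option α) (base : ℕ) (l : List α) : Prop :=
  ∀ i v, l[i]? = some v → f (base + i) = some v

namespace Stored

variable {α : Type*} {f : ℕ → Option α} {base : ℕ}

theorem nil : Stored f base [] := by
  intro i v h
  simp at h

theorem cons_iff {a : α} {l : List α} :
    Stored f base (a :: l) ↔ f base = some a ∧ Stored f (base + 1) l := by
  constructor
  · intro h
    refine ⟨h 0 a (by simp), fun i v hi => ?_⟩
    have := h (i + 1) v (by simpa using hi)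
    rwa [show base + 1 + i = base + (i + 1) by omega]
  · rintro ⟨h0, h1⟩ i v hi
    cases i with
    | zero =>
      simp only [List.getElem?_cons_zero, Option.some.injEq] at hi
      simpa [← hi] using h0
    | succ i =>
      have := h1 i v (by simpa using hi)
      rwa [show base + (i + 1) = base + 1 + i by omega]

theorem append_iff {l₁ l₂ : List α} :
    Stored f base (l₁ ++ l₂) ↔ Stored f base l₁ ∧ Stored f (base + l₁.length) l₂ := by
  induction l₁ generalizing base with
  | nil => simp [nil]
  | cons a l ih =>
    rw [List.cons_append, cons_iff, cons_iff, ih, and_assoc, List.length_cons,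
      show base + 1 + l.length = base + (l.length + 1) by omega]

theorem self (l : List α) : Stored (fun i => l[i]?) 0 l := by
  intro i v h
  simpa using h

end Stored

/-! ### Arithmetic of words and compilation of expressions. -/

namespace WordRAM

/-- The operations on words, read as natural numbers. -/
def Op.natEval (w : ℕ) : Op → ℕ → ℕ → ℕ
  | .add, x, y => (x + y) % 2 ^ w
  | .sub, x, y => (2 ^ w - y + x) % 2 ^ w
  | .mul, x, y => x * y % 2 ^ w
  | .div, x, y => x / y
  | .mod, x, y => x % y
  | .and, x, y => x &&& y
  | .or, x, y => x ||| y
  | .xor, x, y => x ^^^ y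
  | .shl, x, y => (x <<< y) % 2 ^ w
  | .shr, x, y => x >>> y

theorem Op.toNat_eval {w : ℕ} (o : Op) (x y : BitVec w) :
    (o.eval x y).toNat = o.natEval w x.toNat y.toNat := by
  cases o <;> simp [Op.eval, Op.natEval]

theorem run_add {w : ℕ} {prog : List Instr} {s t₁ t₂ : ℕ} {σ σ₁ σ₂ : Config w}
    (h₁ : run prog s t₁ σ = some σ₁) (h₂ : run prog s t₂ σ₁ = some σ₂) :
    run prog s (t₁ + t₂) σ = some σ₂ := by
  induction t₁ generalizing σ with
  | zero =>
    simp only [run, Option.some.injEq] at h₁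
    simpa [h₁] using h₂
  | succ t ih =>
    rw [run, Option.bind_eq_some_iff] at h₁
    obtain ⟨σ', hs, hr⟩ := h₁
    rw [show t + 1 + t₂ = (t + t₂) + 1 by omega, run, hs]
    exact ih hr

theorem run_one {w : ℕ} {prog : List Instr} {s : ℕ} {σ σ₁ : Config w}
    (h : step prog s σ = some σ₁) : run prog s 1 σ = some σ₁ := by
  simp [run, h]

/-- Expressions over the variables, which are the registers of the machine. -/
inductive Exp where
  | var (r : ℕ)
  | lit (k : ℕ)
  | bin (o : Op) (a b : Exp)
  | get (a : Exp)

namespace Exp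

/-- The value of an expression; there is none if a cell outside the memory is read. -/
def eval (w : ℕ) (mem : ℕ → Option ℕ) (ρ : ℕ → ℕ) : Exp → Option ℕ
  | var r => some (ρ r)
  | lit k => some (k % 2 ^ w)
  | bin o a b => (a.eval w mem ρ).bind fun x => (b.eval w mem ρ).bind fun y => some (o.natEval w x y)
  | get a => (a.eval w mem ρ).bind mem

/-- Code that leaves the value of an expression in register `d` and changes no register below. -/
def code (d : ℕ) : Exp → List Instr
  | var r => [.move d r]
  | lit k => [.const d k]
  | bin o a b => a.code d ++ (b.code (d + 1) ++ [.op o d d (d + 1)])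
  | get a => a.code d ++ [.load d d]

/-- The number of instructions of the code. -/
def cost : Exp → ℕ
  | var _ => 1
  | lit _ => 1
  | bin _ a b => a.cost + (b.cost + 1)
  | get a => a.cost + 1

/-- All variables of the expression are below `V`. -/
def varsLt (V : ℕ) : Exp → Bool
  | var r => decide (r < V)
  | lit _ => true
  | bin _ a b => a.varsLt V && b.varsLt V
  | get a => a.varsLt V

theorem length_code (e : Exp) (d : ℕ) : (e.code d).length = e.cost := by
  induction e generalizing d <;> simp_all [code, cost]

/-- Registers are used as a stack: the value goes to `d`, and subterms only use registers from `d`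
on, so the left operand in `d` survives the evaluation of the right one in `d + 1`. The partial map
`mem` knows only the cells of the data structure; an expression that has a value is therefore
independent of all other cells. -/
theorem run_code {w s V : ℕ} {prog : List Instr} {mem : ℕ → Option ℕ} {ρ : ℕ → ℕ} (e : Exp)
    (hV : e.varsLt V = true) {d : ℕ} (hd : V ≤ d) {σ : Config w}
    (hcode : Stored (fun i => prog[i]?) σ.pc (e.code d))
    (hρ : ∀ r < V, (σ.reg r).toNat = ρ r)
    (hmem : ∀ a v, mem a = some v → a < s ∧ (σ.mem a).toNat = v)
    {v : ℕ} (hv : e.eval w mem ρ = some v) :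
    ∃ σ' : Config w, run prog s e.cost σ = some σ' ∧ σ'.pc = σ.pc + e.cost ∧
      (∀ r < d, σ'.reg r = σ.reg r) ∧ (σ'.reg d).toNat = v ∧ σ'.mem = σ.mem ∧ σ'.out = σ.out := by
  induction e generalizing d σ v with
  | var r =>
    simp only [varsLt, decide_eq_true_eq] at hV
    rw [code, Stored.cons_iff] at hcode
    simp only [eval, Option.some.injEq] at hv
    have hstep : step prog s σ = some
        { σ with pc := σ.pc + 1, reg := Function.update σ.reg d (σ.reg r) } := by
      simp only [step, hcode.1]
    refine ⟨_, run_one hstep, rfl, fun r' hr' => ?_, ?_, rfl, rfl⟩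
    · exact Function.update_of_ne (by omega) _ _
    · simp [hρ r hV, hv]
  | lit k =>
    rw [code, Stored.cons_iff] at hcode
    simp only [eval, Option.some.injEq] at hv
    have hstep : step prog s σ = some
        { σ with pc := σ.pc + 1, reg := Function.update σ.reg d (BitVec.ofNat w k) } := by
      simp only [step, hcode.1]
    refine ⟨_, run_one hstep, rfl, fun r' hr' => ?_, ?_, rfl, rfl⟩
    · exact Function.update_of_ne (by omega) _ _
    · simp [hv]
  | bin o a b iha ihb =>
    simp only [varsLt, Bool.and_eq_true] at hV
    rw [code, Stored.append_iff, Stored.append_iff, Stored.cons_iff, length_code,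
      length_code] at hcode
    obtain ⟨hca, hcb, hco, -⟩ := hcode
    simp only [eval, Option.bind_eq_some_iff, Option.some.injEq] at hv
    obtain ⟨x, hx, y, hy, hv⟩ := hv
    obtain ⟨σ₁, hr₁, hp₁, hf₁, hv₁, hm₁, ho₁⟩ := iha hV.1 hd hca hρ hmem hx
    rw [← hp₁] at hcb hco
    obtain ⟨σ₂, hr₂, hp₂, hf₂, hv₂, hm₂, ho₂⟩ := ihb hV.2 (d := d + 1) (by omega) hcb
      (fun r hr => by rw [hf₁ r (by omega), hρ r hr]) (by rw [hm₁]; exact hmem) hy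
    rw [← hp₂] at hco
    have hstep : step prog s σ₂ = some { σ₂ with
        pc := σ₂.pc + 1
        reg := Function.update σ₂.reg d (o.eval (σ₂.reg d) (σ₂.reg (d + 1))) } := by
      simp only [step, hco]
    refine ⟨_, run_add hr₁ (run_add hr₂ (run_one hstep)), ?_, fun r hr => ?_, ?_, ?_, ?_⟩
    · simp only [hp₁, hp₂, cost]; omega
    · simp only [Function.update_of_ne (show r ≠ d by omega)]
      rw [hf₂ r (by omega), hf₁ r hr]
    · simp only [Function.update_self, Op.toNat_eval]
      rw [hf₂ d (by omega), hv₁, hv₂, hv]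
    · exact hm₂.trans hm₁
    · exact ho₂.trans ho₁
  | get a iha =>
    rw [code, Stored.append_iff, Stored.cons_iff, length_code] at hcode
    obtain ⟨hca, hco, -⟩ := hcode
    simp only [eval, Option.bind_eq_some_iff] at hv
    obtain ⟨x, hx, hv⟩ := hv
    obtain ⟨σ₁, hr₁, hp₁, hf₁, hv₁, hm₁, ho₁⟩ := iha hV hd hca hρ hmem hx
    rw [← hp₁] at hco
    obtain ⟨hxs, hxv⟩ := hmem x v hv
    have hstep : step prog s σ₁ = some { σ₁ with
        pc := σ₁.pc + 1, reg := Function.update σ₁.reg d (σ₁.mem (σ₁.reg d).toNat) } := by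
      simp only [step, hco, hv₁, if_pos hxs]
    refine ⟨_, run_add hr₁ (run_one hstep), ?_, fun r hr => ?_, ?_, hm₁, ho₁⟩
    · simp only [hp₁, cost]; omega
    · simp only [Function.update_of_ne (show r ≠ d by omega)]
      rw [hf₁ r hr]
    · simp only [Function.update_self]
      rw [hv₁, hm₁, hxv]

end Exp

/-! ### Structured programs, their cost semantics and their compilation. -/

/-- Structured programs that do not write to the memory. -/
inductive Stmt where
  | assign (r : ℕ) (e : Exp)
  | output (e : Exp)
  | seq (c₁ c₂ : Stmt)
  | ifLt (e₁ e₂ : Exp) (c₁ c₂ : Stmt)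
  | whileLt (e₁ e₂ : Exp) (c : Stmt)

/-- The values of the variables and what has been reported. -/
structure Store where
  val : ℕ → ℕ
  out : List ℕ

/-- `Store` after an assignment. -/
def Store.set (σ : Store) (r v : ℕ) : Store := ⟨Function.update σ.val r v, σ.out⟩

namespace Stmt

/-- The length of the code. -/
def len : Stmt → ℕ
  | assign _ e => e.cost + 1
  | output e => e.cost + 1
  | seq c₁ c₂ => c₁.len + c₂.len
  | ifLt e₁ e₂ c₁ c₂ => e₁.cost + (e₂.cost + (1 + (c₂.len + (1 + c₁.len))))
  | whileLt e₁ e₂ c => e₁.cost + (e₂.cost + (2 + (c.len + 1)))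

/-- The code, to be placed at position `p`; registers from `V` on hold intermediate results. -/
def code (V : ℕ) : ℕ → Stmt → List Instr
  | _, assign r e => e.code V ++ [.move r V]
  | _, output e => e.code V ++ [.output V]
  | p, seq c₁ c₂ => c₁.code V p ++ c₂.code V (p + c₁.len)
  | p, ifLt e₁ e₂ c₁ c₂ =>
    e₁.code V ++ (e₂.code (V + 1) ++
      ([.jumpLt V (V + 1) (p + e₁.cost + e₂.cost + 1 + c₂.len + 1)] ++
        (c₂.code V (p + e₁.cost + e₂.cost + 1) ++
          ([.jump (p + e₁.cost + e₂.cost + 1 + c₂.len + 1 + c₁.len)] ++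
            c₁.code V (p + e₁.cost + e₂.cost + 1 + c₂.len + 1)))))
  | p, whileLt e₁ e₂ c =>
    e₁.code V ++ (e₂.code (V + 1) ++
      ([.jumpLt V (V + 1) (p + e₁.cost + e₂.cost + 2),
        .jump (p + e₁.cost + e₂.cost + 2 + c.len + 1)] ++
        (c.code V (p + e₁.cost + e₂.cost + 2) ++ [.jump p])))

/-- All variables of the program are below `V`. -/
def varsLt (V : ℕ) : Stmt → Bool
  | assign r e => decide (r < V) && e.varsLt V
  | output e => e.varsLt V
  | seq c₁ c₂ => c₁.varsLt V && c₂.varsLt V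
  | ifLt e₁ e₂ c₁ c₂ => e₁.varsLt V && e₂.varsLt V && c₁.varsLt V && c₂.varsLt V
  | whileLt e₁ e₂ c => e₁.varsLt V && e₂.varsLt V && c.varsLt V

theorem length_code (V : ℕ) (c : Stmt) (p : ℕ) : (c.code V p).length = c.len := by
  induction c generalizing p <;> simp_all [code, len, Exp.length_code] <;> omega

/-- `Exec w mem c σ σ' t`: the program `c` takes the store `σ` to `σ'` in `t` steps. -/
inductive Exec (w : ℕ) (mem : ℕ → Option ℕ) : Stmt → Store → Store → ℕ → Prop where
  | assign {r e σ v} : e.eval w mem σ.val = some v → Exec w mem (.assign r e) σ (σ.set r v) (e.cost + 1)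
  | output {e σ v} : e.eval w mem σ.val = some v →
      Exec w mem (.output e) σ ⟨σ.val, σ.out ++ [v]⟩ (e.cost + 1)
  | seq {c₁ c₂ σ σ₁ σ₂ t₁ t₂} : Exec w mem c₁ σ σ₁ t₁ → Exec w mem c₂ σ₁ σ₂ t₂ →
      Exec w mem (.seq c₁ c₂) σ σ₂ (t₁ + t₂)
  | ifTrue {e₁ e₂ c₁ c₂ σ σ' x y t} : e₁.eval w mem σ.val = some x →
      e₂.eval w mem σ.val = some y → x < y → Exec w mem c₁ σ σ' t →
      Exec w mem (.ifLt e₁ e₂ c₁ c₂) σ σ' (e₁.cost + (e₂.cost + (1 + t)))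
  | ifFalse {e₁ e₂ c₁ c₂ σ σ' x y t} : e₁.eval w mem σ.val = some x →
      e₂.eval w mem σ.val = some y → ¬ x < y → Exec w mem c₂ σ σ' t →
      Exec w mem (.ifLt e₁ e₂ c₁ c₂) σ σ' (e₁.cost + (e₂.cost + (1 + (t + 1))))
  | whileTrue {e₁ e₂ c σ σ₁ σ₂ x y t₁ t₂} : e₁.eval w mem σ.val = some x →
      e₂.eval w mem σ.val = some y → x < y → Exec w mem c σ σ₁ t₁ →
      Exec w mem (.whileLt e₁ e₂ c) σ₁ σ₂ t₂ →
      Exec w mem (.whileLt e₁ e₂ c) σ σ₂ (e₁.cost + (e₂.cost + (1 + (t₁ + (1 + t₂)))))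
  | whileFalse {e₁ e₂ c σ x y} : e₁.eval w mem σ.val = some x →
      e₂.eval w mem σ.val = some y → ¬ x < y →
      Exec w mem (.whileLt e₁ e₂ c) σ σ (e₁.cost + (e₂.cost + 2))

/-- The configuration `σ` represents the store `τ`. -/
structure Represents {w : ℕ} (V s : ℕ) (mem : ℕ → Option ℕ) (τ : Store) (σ : Config w) : Prop where
  val : ∀ r < V, (σ.reg r).toNat = τ.val r
  mem : ∀ a v, mem a = some v → a < s ∧ (σ.mem a).toNat = v
  out : σ.out.map BitVec.toNat = τ.out

theorem run_compare {w s V : ℕ} {prog : List Instr} {mem : ℕ → Option ℕ} {τ : Store}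
    {e₁ e₂ : Exp} (h₁ : e₁.varsLt V = true) (h₂ : e₂.varsLt V = true) {σ : Config w}
    (hσ : Represents V s mem τ σ)
    (hc₁ : Stored (fun i => prog[i]?) σ.pc (e₁.code V))
    (hc₂ : Stored (fun i => prog[i]?) (σ.pc + e₁.cost) (e₂.code (V + 1)))
    {x y l : ℕ} (hx : e₁.eval w mem τ.val = some x) (hy : e₂.eval w mem τ.val = some y)
    (hj : prog[σ.pc + e₁.cost + e₂.cost]? = some (.jumpLt V (V + 1) l)) :
    ∃ σ' : Config w, run prog s (e₁.cost + (e₂.cost + 1)) σ = some σ' ∧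
      Represents V s mem τ σ' ∧ σ'.mem = σ.mem ∧
      σ'.pc = if x < y then l else σ.pc + e₁.cost + e₂.cost + 1 := by
  obtain ⟨σ₁, hr₁, hp₁, hf₁, hv₁, hm₁, ho₁⟩ := e₁.run_code h₁ le_rfl hc₁ hσ.val hσ.mem hx
  rw [← hp₁] at hc₂ hj
  obtain ⟨σ₂, hr₂, hp₂, hf₂, hv₂, hm₂, ho₂⟩ := e₂.run_code h₂ (Nat.le_succ V) hc₂
    (fun r hr => by rw [hf₁ r hr, hσ.val r hr]) (by rw [hm₁]; exact hσ.mem) hy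
  rw [← hp₂] at hj
  have hstep : step prog s σ₂ = some { σ₂ with
      pc := if (σ₂.reg V).toNat < (σ₂.reg (V + 1)).toNat then l else σ₂.pc + 1 } := by
    simp only [step, hj]
  refine ⟨_, run_add hr₁ (run_add hr₂ (run_one hstep)), ⟨fun r hr => ?_, ?_, ?_⟩, ?_, ?_⟩
  · show (σ₂.reg r).toNat = _
    rw [hf₂ r (by omega), hf₁ r hr, hσ.val r hr]
  · show ∀ a v, mem a = some v → a < s ∧ (σ₂.mem a).toNat = v
    rw [hm₂, hm₁]; exact hσ.mem
  · show σ₂.out.map _ = _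
    rw [ho₂, ho₁, hσ.out]
  · exact hm₂.trans hm₁
  · show (if (σ₂.reg V).toNat < _ then l else σ₂.pc + 1) = _
    rw [hv₂, hf₂ V (by omega), hv₁, hp₂, hp₁]

theorem run_jump {w s : ℕ} {prog : List Instr} {σ : Config w} {l : ℕ}
    (h : prog[σ.pc]? = some (.jump l)) : run prog s 1 σ = some { σ with pc := l } :=
  run_one (by simp only [step, h])

/-- The induction is on the execution, not on the program: after one round of a loop, the rest of
the execution belongs to the same loop at the same position. -/
theorem run_code {w s V : ℕ} {prog : List Instr} {mem : ℕ → Option ℕ} {c : Stmt} {τ τ' : Store}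
    {t : ℕ} (h : Exec w mem c τ τ' t) (hV : c.varsLt V = true) {σ : Config w}
    (hcode : Stored (fun i => prog[i]?) σ.pc (c.code V σ.pc)) (hσ : Represents V s mem τ σ) :
    ∃ σ' : Config w, run prog s t σ = some σ' ∧ σ'.pc = σ.pc + c.len ∧
      Represents V s mem τ' σ' ∧ σ'.mem = σ.mem := by
  induction h generalizing σ with
  | @assign r e τ v hv =>
    simp only [varsLt, Bool.and_eq_true, decide_eq_true_eq] at hV
    rw [code, Stored.append_iff, Stored.cons_iff, Exp.length_code] at hcode
    obtain ⟨hc, hi, -⟩ := hcode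
    obtain ⟨σ₁, hr₁, hp₁, hf₁, hv₁, hm₁, ho₁⟩ := e.run_code hV.2 le_rfl hc hσ.val hσ.mem hv
    rw [← hp₁] at hi
    have hstep : step prog s σ₁ = some
        { σ₁ with pc := σ₁.pc + 1, reg := Function.update σ₁.reg r (σ₁.reg V) } := by
      simp only [step, hi]
    refine ⟨_, run_add hr₁ (run_one hstep), ?_, ⟨fun r' hr' => ?_, ?_, ?_⟩, hm₁⟩
    · simp only [hp₁, len]; omega
    · simp only [Store.set, Function.update_apply]
      split_ifs with h
      · exact hv₁
      · rw [hf₁ r' hr', hσ.val r' hr']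
    · show ∀ a v, mem a = some v → a < s ∧ (σ₁.mem a).toNat = v
      rw [hm₁]; exact hσ.mem
    · show σ₁.out.map _ = _
      rw [ho₁, hσ.out]; rfl
  | @output e τ v hv =>
    simp only [varsLt] at hV
    rw [code, Stored.append_iff, Stored.cons_iff, Exp.length_code] at hcode
    obtain ⟨hc, hi, -⟩ := hcode
    obtain ⟨σ₁, hr₁, hp₁, hf₁, hv₁, hm₁, ho₁⟩ := e.run_code hV le_rfl hc hσ.val hσ.mem hv
    rw [← hp₁] at hi
    have hstep : step prog s σ₁ = some
        { σ₁ with pc := σ₁.pc + 1, out := σ₁.out ++ [σ₁.reg V] } := by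
      simp only [step, hi]
    refine ⟨_, run_add hr₁ (run_one hstep), ?_, ⟨fun r' hr' => ?_, ?_, ?_⟩, hm₁⟩
    · simp only [hp₁, len]; omega
    · show (σ₁.reg r').toNat = _
      rw [hf₁ r' hr', hσ.val r' hr']
    · show ∀ a v, mem a = some v → a < s ∧ (σ₁.mem a).toNat = v
      rw [hm₁]; exact hσ.mem
    · show (σ₁.out ++ [σ₁.reg V]).map _ = _
      rw [List.map_append, ho₁, hσ.out]
      simp [hv₁]
  | @seq c₁ c₂ τ τ₁ τ₂ t₁ t₂ _ _ ih₁ ih₂ =>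
    simp only [varsLt, Bool.and_eq_true] at hV
    rw [code, Stored.append_iff, length_code] at hcode
    obtain ⟨σ₁, hr₁, hp₁, hs₁, hm₁⟩ := ih₁ hV.1 hcode.1 hσ
    obtain ⟨σ₂, hr₂, hp₂, hs₂, hm₂⟩ := ih₂ hV.2 (by rw [hp₁]; exact hcode.2) hs₁
    refine ⟨σ₂, run_add hr₁ hr₂, ?_, hs₂, hm₂.trans hm₁⟩
    rw [hp₂, hp₁, len]; omega
  | @ifTrue e₁ e₂ c₁ c₂ τ τ' x y t hx hy hxy _ ih =>
    simp only [varsLt, Bool.and_eq_true] at hV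
    rw [code] at hcode
    simp only [Stored.append_iff, Stored.cons_iff, Exp.length_code, length_code,
      List.length_singleton] at hcode
    obtain ⟨hc₁, hc₂, ⟨hj, -⟩, -, -, hc⟩ := hcode
    obtain ⟨σ₁, hr₁, hs₁, hm₁, hp₁⟩ := run_compare hV.1.1.1 hV.1.1.2 hσ hc₁ hc₂ hx hy hj
    rw [if_pos hxy] at hp₁
    obtain ⟨σ₂, hr₂, hp₂, hs₂, hm₂⟩ := ih hV.1.2 (by rw [hp₁]; exact hc) hs₁
    refine ⟨σ₂, ?_, ?_, hs₂, hm₂.trans hm₁⟩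
    · rw [show e₁.cost + (e₂.cost + (1 + t)) = e₁.cost + (e₂.cost + 1) + t by omega]
      exact run_add hr₁ hr₂
    · rw [hp₂, hp₁, len]; omega
  | @ifFalse e₁ e₂ c₁ c₂ τ τ' x y t hx hy hxy _ ih =>
    simp only [varsLt, Bool.and_eq_true] at hV
    rw [code] at hcode
    simp only [Stored.append_iff, Stored.cons_iff, Exp.length_code, length_code,
      List.length_singleton] at hcode
    obtain ⟨hc₁, hc₂, ⟨hj, -⟩, hc, ⟨he, -⟩, -⟩ := hcode
    obtain ⟨σ₁, hr₁, hs₁, hm₁, hp₁⟩ := run_compare hV.1.1.1 hV.1.1.2 hσ hc₁ hc₂ hx hy hj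
    rw [if_neg hxy] at hp₁
    obtain ⟨σ₂, hr₂, hp₂, hs₂, hm₂⟩ := ih hV.2 (by rw [hp₁]; exact hc) hs₁
    rw [← hp₁, ← hp₂] at he
    refine ⟨{ σ₂ with pc := σ₂.pc + 1 + c₁.len }, ?_, ?_, ⟨hs₂.val, hs₂.mem, hs₂.out⟩,
      hm₂.trans hm₁⟩
    · rw [show e₁.cost + (e₂.cost + (1 + (t + 1))) = e₁.cost + (e₂.cost + 1) + (t + 1) by omega]
      exact run_add hr₁ (run_add hr₂ (run_jump he))
    · simp only [len, hp₂, hp₁]; omega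
  | @whileTrue e₁ e₂ c τ τ₁ τ₂ x y t₁ t₂ hx hy hxy _ _ ih₁ ih₂ =>
    have hV' := hV
    have hcode' := hcode
    simp only [varsLt, Bool.and_eq_true] at hV
    rw [code] at hcode
    simp only [Stored.append_iff, Stored.cons_iff, Exp.length_code, length_code,
      List.length_cons, List.length_nil] at hcode
    obtain ⟨hc₁, hc₂, ⟨hj, -⟩, hc, he, -⟩ := hcode
    obtain ⟨σ₁, hr₁, hs₁, hm₁, hp₁⟩ := run_compare hV.1.1 hV.1.2 hσ hc₁ hc₂ hx hy hj
    rw [if_pos hxy] at hp₁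
    obtain ⟨σ₂, hr₂, hp₂, hs₂, hm₂⟩ := ih₁ hV.2 (by rw [hp₁]; exact hc) hs₁
    have he' : prog[σ₂.pc]? = some (.jump σ.pc) := by
      rw [hp₂, hp₁]; exact he
    obtain ⟨σ₃, hr₃, hp₃, hs₃, hm₃⟩ := ih₂ (σ := { σ₂ with pc := σ.pc }) hV' hcode'
      ⟨hs₂.val, hs₂.mem, hs₂.out⟩
    refine ⟨σ₃, ?_, hp₃, hs₃, hm₃.trans (hm₂.trans hm₁)⟩
    rw [show e₁.cost + (e₂.cost + (1 + (t₁ + (1 + t₂)))) =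
      e₁.cost + (e₂.cost + 1) + (t₁ + (1 + t₂)) by omega]
    exact run_add hr₁ (run_add hr₂ (run_add (run_jump he') hr₃))
  | @whileFalse e₁ e₂ c τ x y hx hy hxy =>
    simp only [varsLt, Bool.and_eq_true] at hV
    rw [code] at hcode
    simp only [Stored.append_iff, Stored.cons_iff, Exp.length_code, length_code,
      List.length_cons, List.length_nil] at hcode
    obtain ⟨hc₁, hc₂, ⟨hj, he, -⟩, -⟩ := hcode
    obtain ⟨σ₁, hr₁, hs₁, hm₁, hp₁⟩ := run_compare hV.1.1 hV.1.2 hσ hc₁ hc₂ hx hy hj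
    rw [if_neg hxy] at hp₁
    rw [← hp₁] at he
    refine ⟨{ σ₁ with pc := σ.pc + e₁.cost + e₂.cost + 2 + c.len + 1 }, ?_, ?_,
      ⟨hs₁.val, hs₁.mem, hs₁.out⟩, hm₁⟩
    · rw [show e₁.cost + (e₂.cost + 2) = e₁.cost + (e₂.cost + 1) + 1 by omega]
      exact run_add hr₁ (run_jump he)
    · simp only [len]; omega

/-! ### A program logic with time bounds. -/

/-- From the store `σ` the program `c` comes to an end with `Q`, and the number of steps is at most
`K` times the length of its code. -/
def WP (w : ℕ) (mem : ℕ → Option ℕ) (c : Stmt) (K : ℕ) (Q : Store → Prop) (σ : Store) : Prop :=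
  ∃ t ≤ c.len * K, ∃ σ', Exec w mem c σ σ' t ∧ Q σ'

namespace WP

variable {w : ℕ} {mem : ℕ → Option ℕ} {σ : Store} {Q : Store → Prop} {K : ℕ}

theorem mono {c : Stmt} {K' : ℕ} {Q' : Store → Prop} (h : WP w mem c K Q σ) (hK : K ≤ K')
    (hQ : ∀ σ', Q σ' → Q' σ') : WP w mem c K' Q' σ := by
  obtain ⟨t, ht, σ', he, hq⟩ := h
  exact ⟨t, ht.trans (Nat.mul_le_mul_left _ hK), σ', he, hQ _ hq⟩

theorem assign (hK : 0 < K) {r : ℕ} {e : Exp} {v : ℕ} (hv : e.eval w mem σ.val = some v)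
    (hQ : Q (σ.set r v)) : WP w mem (.assign r e) K Q σ :=
  ⟨_, Nat.le_mul_of_pos_right _ hK, _, .assign hv, hQ⟩

theorem output (hK : 0 < K) {e : Exp} {v : ℕ} (hv : e.eval w mem σ.val = some v)
    (hQ : Q ⟨σ.val, σ.out ++ [v]⟩) : WP w mem (.output e) K Q σ :=
  ⟨_, Nat.le_mul_of_pos_right _ hK, _, .output hv, hQ⟩

/-- Time is measured as code length times `K`, and lengths add up, so both parts and the whole share
one `K` and no constants have to be tracked. Only loops enlarge `K`. -/
theorem seq {c₁ c₂ : Stmt} (h : WP w mem c₁ K (WP w mem c₂ K Q) σ) :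
    WP w mem (.seq c₁ c₂) K Q σ := by
  obtain ⟨t₁, ht₁, σ₁, he₁, t₂, ht₂, σ₂, he₂, hq⟩ := h
  refine ⟨_, ?_, σ₂, .seq he₁ he₂, hq⟩
  rw [len, add_mul]
  exact Nat.add_le_add ht₁ ht₂

theorem ifLt (hK : 0 < K) {e₁ e₂ : Exp} {c₁ c₂ : Stmt} {x y : ℕ}
    (hx : e₁.eval w mem σ.val = some x) (hy : e₂.eval w mem σ.val = some y)
    (h₁ : x < y → WP w mem c₁ K Q σ) (h₂ : ¬ x < y → WP w mem c₂ K Q σ) :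
    WP w mem (.ifLt e₁ e₂ c₁ c₂) K Q σ := by
  have he₁ := Nat.le_mul_of_pos_right e₁.cost hK
  have he₂ := Nat.le_mul_of_pos_right e₂.cost hK
  by_cases hxy : x < y
  · obtain ⟨t, ht, σ', he, hq⟩ := h₁ hxy
    refine ⟨_, ?_, σ', .ifTrue hx hy hxy he, hq⟩
    simp only [len, add_mul]
    omega
  · obtain ⟨t, ht, σ', he, hq⟩ := h₂ hxy
    refine ⟨_, ?_, σ', .ifFalse hx hy hxy he, hq⟩
    simp only [len, add_mul]
    omega

/-- The rule for loops: `I n` is the invariant when at most `n` rounds are left. -/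
theorem whileLt (hK : 0 < K) {e₁ e₂ : Exp} {c : Stmt} (I : ℕ → Store → Prop)
    (hI : ∀ n σ, I n σ → ∃ x y, e₁.eval w mem σ.val = some x ∧ e₂.eval w mem σ.val = some y ∧
      (x < y → ∃ m, n = m + 1 ∧ WP w mem c K (I m) σ) ∧ (¬ x < y → Q σ))
    (n : ℕ) (hσ : I n σ) : WP w mem (.whileLt e₁ e₂ c) (K * (n + 1)) Q σ := by
  have he₁ := Nat.le_mul_of_pos_right e₁.cost hK
  have he₂ := Nat.le_mul_of_pos_right e₂.cost hK
  induction n generalizing σ with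
  | zero =>
    obtain ⟨x, y, hx, hy, hlt, hge⟩ := hI 0 σ hσ
    by_cases hxy : x < y
    · obtain ⟨m, hm, -⟩ := hlt hxy
      omega
    · refine ⟨_, ?_, σ, .whileFalse hx hy hxy, hge hxy⟩
      simp only [len, add_mul, Nat.zero_add, mul_one]
      omega
  | succ n ih =>
    obtain ⟨x, y, hx, hy, hlt, hge⟩ := hI _ σ hσ
    have hstep : (Stmt.whileLt e₁ e₂ c).len * (K * (n + 1 + 1)) =
      (Stmt.whileLt e₁ e₂ c).len * (K * (n + 1)) + (Stmt.whileLt e₁ e₂ c).len * K := by ring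
    -- A full round with its test and both transfers of control fits into one share `len * K`; the
    -- `1` in `n + 1` pays for the last, failing test.
    have hround : e₁.cost + (e₂.cost + (2 + c.len * K)) ≤ (Stmt.whileLt e₁ e₂ c).len * K := by
      simp only [len, add_mul]
      omega
    by_cases hxy : x < y
    · obtain ⟨m, hm, t₁, ht₁, σ₁, he₁, hI₁⟩ := hlt hxy
      obtain rfl : n = m := by omega
      obtain ⟨t₂, ht₂, σ₂, he₂, hq⟩ := ih hI₁
      refine ⟨_, ?_, σ₂, .whileTrue hx hy hxy he₁ he₂, hq⟩
      rw [hstep]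
      omega
    · refine ⟨_, ?_, σ, .whileFalse hx hy hxy, hge hxy⟩
      rw [hstep]
      omega

end WP

end Stmt

end WordRAM

/-! ### Layout of linked data in memory. -/

/-- At every place of the memory with `N` words left, at most `N` words suffice to store an object
with the property `Q` (which has the memory and the address of the object as arguments). -/
def Placeable (w N : ℕ) (Q : (ℕ → Option ℕ) → ℕ → Prop) : Prop :=
  ∀ base, base + N < 2 ^ w → ∃ l : List ℕ, l.length ≤ N ∧ (∀ v ∈ l, v < 2 ^ w) ∧
    ∀ mem, Stored mem base l → Q mem base

namespace Placeable

variable {w N N' : ℕ} {Q Q' : (ℕ → Option ℕ) → ℕ → Prop}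

theorem mono (h : Placeable w N Q) (hN : N ≤ N') (hQ : ∀ mem p, Q mem p → Q' mem p) :
    Placeable w N' Q' := by
  intro base hb
  obtain ⟨l, hl, hv, hq⟩ := h base (by omega)
  exact ⟨l, hl.trans hN, hv, fun mem hm => hQ _ _ (hq mem hm)⟩

/-- Without room for `N` words there is nothing to show. This is what makes lengths, counts and
shifts representable as words in the constructions below. -/
theorem of_lt (h : N < 2 ^ w → Placeable w N Q) : Placeable w N Q :=
  fun base hb => h (by omega) base hb

theorem trivial : Placeable w 0 fun _ _ => True :=
  fun _ _ => ⟨[], by simp, by simp, by simp⟩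

theorem consVal {v : ℕ} (hv : v < 2 ^ w) (h : Placeable w N Q) :
    Placeable w (N + 1) fun mem p => mem p = some v ∧ Q mem (p + 1) := by
  intro base hb
  obtain ⟨l, hl, hlv, hq⟩ := h (base + 1) (by omega)
  refine ⟨v :: l, by simpa using hl, by simpa using ⟨hv, hlv⟩, fun mem hm => ?_⟩
  rw [Stored.cons_iff] at hm
  exact ⟨hm.1, hq mem hm.2⟩

/-- The remaining fields of the record come directly after the pointer and the object pointed to
comes after them, so the fields of a record stay consecutive. -/
theorem consPtr (h' : Placeable w N' Q') (h : Placeable w N Q) :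
    Placeable w (N + N' + 1) fun mem p =>
      (∃ a, mem p = some a ∧ Q' mem a) ∧ Q mem (p + 1) := by
  intro base hb
  obtain ⟨l, hl, hlv, hq⟩ := h (base + 1) (by omega)
  obtain ⟨l', hl', hlv', hq'⟩ := h' (base + 1 + l.length) (by omega)
  refine ⟨(base + 1 + l.length) :: (l ++ l'), ?_, ?_, fun mem hm => ?_⟩
  · simp only [List.length_cons, List.length_append]; omega
  · intro v hv
    simp only [List.mem_cons, List.mem_append] at hv
    rcases hv with rfl | hv | hv
    · omega
    · exact hlv v hv
    · exact hlv' v hv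
  · rw [Stored.cons_iff, Stored.append_iff] at hm
    exact ⟨⟨_, hm.1, hq' mem hm.2.2⟩, hq mem hm.2.1⟩

theorem table {T : ℕ} {f : ℕ → ℕ} (hf : ∀ t < T, f t < 2 ^ w) :
    Placeable w T fun mem p => ∀ t < T, mem (p + t) = some (f t) := by
  induction T generalizing f with
  | zero => exact trivial.mono le_rfl (by simp)
  | succ T ih =>
    refine (consVal (hf 0 (by omega)) (ih (f := fun t => f (t + 1))
      fun t ht => hf _ (by omega))).mono le_rfl ?_
    rintro mem p ⟨h0, h⟩ t ht
    cases t with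
    | zero => exact h0
    | succ t =>
      rw [show p + (t + 1) = p + 1 + t by omega]
      exact h t (by omega)

theorem ptrs {T : ℕ} {M : ℕ → ℕ} {R : ℕ → (ℕ → Option ℕ) → ℕ → Prop}
    (h : ∀ t < T, Placeable w (M t) (R t)) :
    Placeable w (∑ t ∈ Finset.range T, (M t + 1)) fun mem p =>
      ∀ t < T, ∃ a, mem (p + t) = some a ∧ R t mem a := by
  induction T generalizing M R with
  | zero => exact trivial.mono (by simp) (by simp)
  | succ T ih =>
    refine (consPtr (h 0 (by omega)) (ih (M := fun t => M (t + 1)) (R := fun t => R (t + 1))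
      fun t ht => h _ (by omega))).mono ?_ ?_
    · rw [Finset.sum_range_succ']
      omega
    · rintro mem p ⟨h0, h⟩ t ht
      cases t with
      | zero => exact h0
      | succ t =>
        rw [show p + (t + 1) = p + 1 + t by omega]
        exact h t (by omega)

end Placeable

/-! Multiply-shift hashing. -/

/-- The multiply-shift hash value of `x` for the multiplier `a`. -/
def mulShift (w sh a x : ℕ) : ℕ := a * x % 2 ^ w / 2 ^ sh

theorem mulShift_lt {w m a x : ℕ} (hm : m ≤ w) : mulShift w (w - m) a x < 2 ^ m := by
  rw [mulShift, Nat.div_lt_iff_lt_mul (by positivity), ← pow_add, show m + (w - m) = w by omega]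
  exact Nat.mod_lt _ (by positivity)

/-- Equal hash values put the residues of `a * x` and `a * y` into the same block of length `2 ^
sh`, so they differ by less than `2 ^ sh`. The residue of `a * (y - x)` is this difference, up to a
wrap-around if it is negative. -/
theorem sub_mod_of_mulShift_eq {w sh a x y : ℕ} (hxy : x ≤ y)
    (h : mulShift w sh a x = mulShift w sh a y) :
    a * (y - x) % 2 ^ w < 2 ^ sh ∨ 2 ^ w - a * (y - x) % 2 ^ w < 2 ^ sh := by
  unfold mulShift at h
  obtain ⟨z, rfl⟩ := Nat.exists_eq_add_of_le hxy
  rw [Nat.add_sub_cancel_left]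
  have hW : 0 < 2 ^ w := by positivity
  have hB : 0 < 2 ^ sh := by positivity
  generalize 2 ^ w = W at *
  generalize 2 ^ sh = B at *
  have h1 := Nat.div_add_mod (a * x % W) B
  have h2 := Nat.div_add_mod (a * (x + z) % W) B
  have h3 := Nat.mod_lt (a * x % W) hB
  have h4 := Nat.mod_lt (a * (x + z) % W) hB
  rw [h] at h1
  have h5 : a * (x + z) % W = (a * x % W + a * z % W) % W := by rw [mul_add, Nat.add_mod]
  have h6 := Nat.mod_lt (a * x) hW
  have h7 := Nat.mod_lt (a * z) hW
  generalize a * (x + z) % W = s at *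
  generalize a * x % W = r at *
  generalize a * z % W = d at *
  by_cases hlt : r + d < W
  · rw [Nat.mod_eq_of_lt hlt] at h5
    omega
  · rw [Nat.mod_eq_sub_mod (by omega), Nat.mod_eq_of_lt (by omega)] at h5
    omega

/-- Write `y - x = 2 ^ t * u` with `u` odd. For an odd multiplier `a`, the residue of `a * (y - x)`
is `2 ^ t` times the nonzero residue of `a * u` modulo `2 ^ (w - t)`, and a collision forces it to
be close to `0` or `2 ^ w`. As `u` is invertible, the residue of `a * u` and the quotient of `a` by
`2 ^ (w - t)` determine `a`, which leaves at most `2 * 2 ^ (w - m)` multipliers. -/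
theorem card_mulShift_eq_le {w m x y : ℕ} (hm : m ≤ w) (hxy : x < y) (hy : y < 2 ^ w) :
    ((Finset.range (2 ^ (w - 1))).filter fun b =>
      mulShift w (w - m) (2 * b + 1) x = mulShift w (w - m) (2 * b + 1) y).card
        ≤ 2 * 2 ^ (w - m) := by
  obtain ⟨t, u, hu, hz⟩ := Nat.exists_eq_two_pow_mul_odd (n := y - x) (by omega)
  have htw : t < w := by
    by_contra hcon
    have h1 : 2 ^ w ≤ 2 ^ t := Nat.pow_le_pow_right (by norm_num) (by omega)
    have h2 : 2 ^ t ≤ 2 ^ t * u := Nat.le_mul_of_pos_right _ hu.pos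
    omega
  obtain ⟨n, hn⟩ : ∃ n, w = t + (n + 1) := ⟨w - t - 1, by omega⟩
  have hW : 2 ^ w = 2 ^ t * 2 ^ (n + 1) := by rw [hn, pow_add]
  have hmod : ∀ b, (2 * b + 1) * (y - x) % 2 ^ w = 2 ^ t * ((2 * b + 1) * u % 2 ^ (n + 1)) := by
    intro b
    rw [hz, hW, ← Nat.mul_mod_mul_left]
    congr 1
    ring
  have hpos : ∀ b, 0 < (2 * b + 1) * u % 2 ^ (n + 1) := by
    intro b
    rw [Nat.pos_iff_ne_zero]
    intro h0
    have hdvd : 2 ∣ (2 * b + 1) * u :=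
      (dvd_pow_self 2 (by omega)).trans (Nat.dvd_of_mod_eq_zero h0)
    have hodd : Odd ((2 * b + 1) * u) := Odd.mul ⟨b, rfl⟩ hu
    exact (Nat.not_even_iff_odd.2 hodd) (even_iff_two_dvd.2 hdvd)
  have hlt : ∀ b, (2 * b + 1) * u % 2 ^ (n + 1) < 2 ^ (n + 1) := fun b =>
    Nat.mod_lt _ (by positivity)
  have hcol : ∀ b, mulShift w (w - m) (2 * b + 1) x = mulShift w (w - m) (2 * b + 1) y →
      2 ^ t * ((2 * b + 1) * u % 2 ^ (n + 1)) < 2 ^ (w - m) ∨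
        2 ^ t * (2 ^ (n + 1) - (2 * b + 1) * u % 2 ^ (n + 1)) < 2 ^ (w - m) := by
    intro b hb
    have := sub_mod_of_mulShift_eq hxy.le hb
    rwa [hmod, hW, ← Nat.mul_sub] at this
  by_cases ht : t < w - m
  · obtain ⟨k, hk⟩ : ∃ k, w - m = t + k := ⟨w - m - t, by omega⟩
    have hpk : 2 ^ (w - m) = 2 ^ t * 2 ^ k := by rw [hk, pow_add]
    have ht0 : 0 < 2 ^ t := by positivity
    -- `E` contains the residues of `a * u` that allow a collision, at both ends of the range; the
    -- quotient has `2 ^ t` possible values.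
    let E := Finset.range (2 ^ k) ∪ Finset.Ico (2 ^ (n + 1) - 2 ^ k) (2 ^ (n + 1))
    have hE : E.card ≤ 2 * 2 ^ k := by
      refine (Finset.card_union_le _ _).trans ?_
      rw [Finset.card_range, Nat.card_Ico]
      omega
    have hcard : (E ×ˢ Finset.range (2 ^ t)).card ≤ 2 * 2 ^ (w - m) := by
      rw [Finset.card_product, Finset.card_range, hpk]
      calc E.card * 2 ^ t ≤ 2 * 2 ^ k * 2 ^ t := Nat.mul_le_mul_right _ hE
        _ = _ := by ring
    refine le_trans (Finset.card_le_card_of_injOn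
      (fun b => ((2 * b + 1) * u % 2 ^ (n + 1), (2 * b + 1) / 2 ^ (n + 1))) ?_ ?_) hcard
    · intro b hb
      rw [Finset.mem_coe, Finset.mem_filter, Finset.mem_range] at hb
      have h1 := hcol b hb.2
      rw [hpk] at h1
      simp only [Finset.coe_product, Set.mem_prod, Finset.mem_coe, Finset.mem_range, E,
        Finset.mem_union, Finset.mem_Ico]
      have h2 := hlt b
      refine ⟨?_, ?_⟩
      · rcases h1 with h1 | h1
        · exact Or.inl (Nat.lt_of_mul_lt_mul_left h1)
        · have := Nat.lt_of_mul_lt_mul_left h1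
          exact Or.inr ⟨by omega, h2⟩
      · rw [Nat.div_lt_iff_lt_mul (by positivity), ← hW]
        have : 2 ^ w = 2 * 2 ^ (w - 1) := by
          rw [← pow_succ']; congr 1; omega
        omega
    · intro b _ b' _ hbb
      simp only [Prod.mk.injEq] at hbb
      have hcop : Nat.Coprime (2 ^ (n + 1)) u :=
        Nat.Coprime.pow_left _ ((Nat.coprime_two_left).2 hu)
      have h1 : 2 * b + 1 ≡ 2 * b' + 1 [MOD 2 ^ (n + 1)] :=
        Nat.ModEq.cancel_right_of_coprime hcop hbb.1
      have h2 := Nat.div_add_mod (2 * b + 1) (2 ^ (n + 1))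
      have h3 := Nat.div_add_mod (2 * b' + 1) (2 ^ (n + 1))
      rw [hbb.2, h1, h3] at h2
      omega
  -- Here `2 ^ t ≥ 2 ^ (w - m)`, and a nonzero multiple of `2 ^ t` is too far from `0` and from `2 ^
  -- w`: no multiplier collides.
  · have hle : 2 ^ (w - m) ≤ 2 ^ t := Nat.pow_le_pow_right (by norm_num) (by omega)
    rw [Finset.filter_false_of_mem]
    · simp
    · intro b _ hb
      have h0 := hpos b
      have h1 := hlt b
      rcases hcol b hb with h | h
      · have := Nat.le_mul_of_pos_right (2 ^ t) h0
        omega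
      · have := Nat.le_mul_of_pos_right (2 ^ t)
          (show 0 < 2 ^ (n + 1) - (2 * b + 1) * u % 2 ^ (n + 1) by omega)
        omega

/-- The pairs of different elements of `S` with the same hash value. -/
def collisions (S : Finset ℕ) (h : ℕ → ℕ) : Finset (ℕ × ℕ) :=
  (S ×ˢ S).filter fun q => q.1 ≠ q.2 ∧ h q.1 = h q.2

/-- Averaging: each ordered pair collides for at most `2 * 2 ^ (w - m)` of the `2 ^ (w - 1)` odd
multipliers, so some multiplier has at most the mean number `4 * S.card ^ 2 / 2 ^ m` of collisions.
-/
theorem exists_mulShift_collisions_le {w m : ℕ} (hw : 1 ≤ w) (hm : m ≤ w) {S : Finset ℕ}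
    (hS : ∀ x ∈ S, x < 2 ^ w) :
    ∃ a < 2 ^ w, (collisions S (mulShift w (w - m) a)).card * 2 ^ m ≤ 4 * S.card ^ 2 := by
  have hpow : 2 ^ w = 2 * 2 ^ (w - 1) := by
    rw [← pow_succ']; congr 1; omega
  have hsum : ∑ b ∈ Finset.range (2 ^ (w - 1)),
      (collisions S (mulShift w (w - m) (2 * b + 1))).card * 2 ^ m ≤
      ∑ b ∈ Finset.range (2 ^ (w - 1)), 4 * S.card ^ 2 := by
    have hpair : ∀ q ∈ S ×ˢ S, ((Finset.range (2 ^ (w - 1))).filter fun b =>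
        q.1 ≠ q.2 ∧ mulShift w (w - m) (2 * b + 1) q.1 = mulShift w (w - m) (2 * b + 1) q.2).card
          ≤ 2 * 2 ^ (w - m) := by
      rintro ⟨x, y⟩ hq
      rw [Finset.mem_product] at hq
      rcases lt_trichotomy x y with h | h | h
      · refine le_trans (Finset.card_le_card ?_) (card_mulShift_eq_le hm h (hS y hq.2))
        intro b hb
        simp only [Finset.mem_filter] at hb ⊢
        exact ⟨hb.1, hb.2.2⟩
      · simp [h]
      · refine le_trans (Finset.card_le_card ?_) (card_mulShift_eq_le hm h (hS x hq.1))
        intro b hb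
        simp only [Finset.mem_filter] at hb ⊢
        exact ⟨hb.1, hb.2.2.symm⟩
    rw [← Finset.sum_mul]
    have hswap : ∑ b ∈ Finset.range (2 ^ (w - 1)),
        (collisions S (mulShift w (w - m) (2 * b + 1))).card =
        ∑ q ∈ S ×ˢ S, ((Finset.range (2 ^ (w - 1))).filter fun b =>
          q.1 ≠ q.2 ∧
            mulShift w (w - m) (2 * b + 1) q.1 = mulShift w (w - m) (2 * b + 1) q.2).card := by
      simp only [collisions, Finset.card_filter]
      exact Finset.sum_comm
    rw [hswap]
    refine le_trans (Nat.mul_le_mul_right _ (Finset.sum_le_card_nsmul _ _ _ hpair)) ?_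
    rw [Finset.card_product, Finset.sum_const, Finset.card_range, smul_eq_mul, smul_eq_mul]
    have h1 : 2 ^ (w - m) * 2 ^ m = 2 * 2 ^ (w - 1) := by
      rw [← pow_add, ← hpow]; congr 1; omega
    calc S.card * S.card * (2 * 2 ^ (w - m)) * 2 ^ m
        = S.card * S.card * 2 * (2 ^ (w - m) * 2 ^ m) := by ring
      _ = 2 ^ (w - 1) * (4 * S.card ^ 2) := by rw [h1]; ring
      _ ≤ _ := le_rfl
  obtain ⟨b, hb, hle⟩ := Finset.exists_le_of_sum_le
    (Finset.nonempty_range_iff.2 (by positivity)) hsum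
  rw [Finset.mem_range] at hb
  exact ⟨2 * b + 1, by omega, hle⟩

/-! Static dictionaries with two levels of hashing. -/

/-- A bucket with its own hash function that holds the function `f` on all words. -/
def BucketAt (w : ℕ) (f : ℕ → ℕ) (mem : ℕ → Option ℕ) (p : ℕ) : Prop :=
  ∃ a sh, mem p = some a ∧ mem (p + 1) = some sh ∧ ∀ x < 2 ^ w, ∃ key v,
    mem (p + 2 + 2 * mulShift w sh a x) = some key ∧
    mem (p + 2 + 2 * mulShift w sh a x + 1) = some v ∧ (if key = x then v else 0) = f x

/-- A dictionary that holds the function `f`. -/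
def DictAt (w : ℕ) (f : ℕ → ℕ) (mem : ℕ → Option ℕ) (p : ℕ) : Prop :=
  ∃ a sh T, mem p = some a ∧ mem (p + 1) = some sh ∧ mem (p + 2) = some T ∧ ∀ x < 2 ^ w, ∃ q g,
    mem (T + mulShift w sh a x) = some q ∧ BucketAt w g mem q ∧ g x = f x

theorem two_pow_clog_le (n : ℕ) (hn : 1 ≤ n) : 2 ^ Nat.clog 2 n ≤ 2 * n := by
  rcases hn.eq_or_lt with rfl | hn
  · simp
  · have h := Nat.pow_pred_clog_lt_self (b := 2) (by norm_num) hn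
    have hpos := Nat.clog_pos (b := 2) (by norm_num) (show 2 ≤ n from hn)
    obtain ⟨c, hc⟩ := Nat.exists_eq_succ_of_ne_zero hpos.ne'
    rw [hc] at h ⊢
    rw [Nat.pred_succ] at h
    rw [pow_succ]
    omega

/-- A table with more than `4 * S.card ^ 2` slots brings the bound on the collisions below `1`, so
some multiplier is injective on `S`. Two words per slot and two for the hash function give the size.
-/
theorem placeable_bucket {w : ℕ} (hw : 1 ≤ w) {S : Finset ℕ} {f : ℕ → ℕ}
    (hS : ∀ x ∈ S, x < 2 ^ w) (hf : ∀ x ∈ S, f x < 2 ^ w) :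
    Placeable w (16 * S.card ^ 2 + 6) (BucketAt w fun x => if x ∈ S then f x else 0) := by
  apply Placeable.of_lt
  intro hlt
  obtain ⟨m, hm⟩ : ∃ m, m = Nat.clog 2 (4 * S.card ^ 2 + 1) := ⟨_, rfl⟩
  have hm1 : 4 * S.card ^ 2 + 1 ≤ 2 ^ m := hm ▸ Nat.le_pow_clog (by norm_num) _
  have hm2 : 2 ^ m ≤ 2 * (4 * S.card ^ 2 + 1) := hm ▸ two_pow_clog_le _ (by omega)
  have hmw : m ≤ w := by
    by_contra hcon
    have : 2 ^ w ≤ 2 ^ m := Nat.pow_le_pow_right (by norm_num) (by omega)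
    omega
  obtain ⟨a, ha, hcol⟩ := exists_mulShift_collisions_le hw hmw hS
  have hinj : ∀ x ∈ S, ∀ y ∈ S, mulShift w (w - m) a x = mulShift w (w - m) a y → x = y := by
    intro x hx y hy hxy
    by_contra hne
    have hmem : (x, y) ∈ collisions S (mulShift w (w - m) a) := by
      simp [collisions, hx, hy, hne, hxy]
    have hc : 1 ≤ (collisions S (mulShift w (w - m) a)).card := Finset.card_pos.2 ⟨_, hmem⟩
    have := Nat.mul_le_mul_right (2 ^ m) hc
    omega
  have hwlt : w < 2 ^ w := Nat.lt_two_pow_self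
  classical
  -- An empty slot holds key `0` and value `0`; a search for `0` that ends there still returns the
  -- default `0`.
  let slot : ℕ → ℕ × ℕ := fun g =>
    if h : ∃ x ∈ S, mulShift w (w - m) a x = g then (h.choose, f h.choose) else (0, 0)
  have hslot_mem : ∀ x ∈ S, slot (mulShift w (w - m) a x) = (x, f x) := by
    intro x hx
    have h : ∃ y ∈ S, mulShift w (w - m) a y = mulShift w (w - m) a x := ⟨x, hx, rfl⟩
    have heq := hinj _ h.choose_spec.1 x hx h.choose_spec.2
    simp only [slot, dif_pos h, heq]
  have hslot : ∀ g, slot g = (0, 0) ∨ ∃ x ∈ S, slot g = (x, f x) := by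
    intro g
    by_cases h : ∃ x ∈ S, mulShift w (w - m) a x = g
    · exact Or.inr ⟨h.choose, h.choose_spec.1, by simp only [slot, dif_pos h]⟩
    · exact Or.inl (by simp only [slot, dif_neg h])
  have hslot_lt : ∀ g, (slot g).1 < 2 ^ w ∧ (slot g).2 < 2 ^ w := by
    intro g
    rcases hslot g with h | ⟨x, hx, h⟩
    · simp [h]
    · rw [h]; exact ⟨hS x hx, hf x hx⟩
  let tab : ℕ → ℕ := fun t => if t % 2 = 0 then (slot (t / 2)).1 else (slot (t / 2)).2
  have htab : ∀ t < 2 * 2 ^ m, tab t < 2 ^ w := by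
    intro t _
    simp only [tab]
    split_ifs
    · exact (hslot_lt _).1
    · exact (hslot_lt _).2
  refine (Placeable.consVal ha (Placeable.consVal (show w - m < 2 ^ w by omega)
    (Placeable.table htab))).mono (by omega) ?_
  rintro mem p ⟨h0, h1, h2⟩
  refine ⟨a, w - m, h0, h1, fun x _ => ?_⟩
  have hg := mulShift_lt (a := a) (x := x) hmw
  have hk := h2 (2 * mulShift w (w - m) a x) (by omega)
  have hv := h2 (2 * mulShift w (w - m) a x + 1) (by omega)
  refine ⟨(slot (mulShift w (w - m) a x)).1, (slot (mulShift w (w - m) a x)).2, ?_, ?_, ?_⟩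
  · rw [show p + 2 = p + 1 + 1 by omega, hk]
    simp [tab]
  · rw [show p + 2 + 2 * mulShift w (w - m) a x + 1 =
      p + 1 + 1 + (2 * mulShift w (w - m) a x + 1) by omega, hv]
    simp only [tab, Nat.mul_add_mod_self_left, Nat.mul_add_div (show 2 > 0 by norm_num)]
    simp
  · by_cases hx : x ∈ S
    · simp [hslot_mem x hx, hx]
    · simp only [if_neg hx]
      rcases hslot (mulShift w (w - m) a x) with h | ⟨y, hy, h⟩
      · simp [h]
      · rw [h, if_neg]
        rintro rfl
        exact hx hy

/-- The squares count the ordered pairs within the fibers, and such a pair is either diagonal or a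
collision. -/
theorem sum_card_fiber_sq_le (S : Finset ℕ) (h : ℕ → ℕ) {T : ℕ} (hT : ∀ x ∈ S, h x < T) :
    ∑ t ∈ Finset.range T, (S.filter fun x => h x = t).card ^ 2 ≤
      S.card + (collisions S h).card := by
  have h1 : ∀ t, (S.filter fun x => h x = t).card ^ 2 =
      (((S ×ˢ S).filter fun q => h q.1 = h q.2).filter fun q => h q.1 = t).card := by
    intro t
    rw [pow_two, ← Finset.card_product]
    congr 1
    ext ⟨x, y⟩
    simp only [Finset.mem_product, Finset.mem_filter]
    constructor
    · rintro ⟨⟨hx, rfl⟩, hy, hxy⟩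
      exact ⟨⟨⟨hx, hy⟩, hxy.symm⟩, rfl⟩
    · rintro ⟨⟨⟨hx, hy⟩, hxy⟩, rfl⟩
      exact ⟨⟨hx, rfl⟩, hy, hxy.symm⟩
  simp only [h1]
  rw [← Finset.card_eq_sum_card_fiberwise (f := fun q : ℕ × ℕ => h q.1)]
  · have hsub : ((S ×ˢ S).filter fun q => h q.1 = h q.2) ⊆ S.diag ∪ collisions S h := by
      rintro ⟨x, y⟩ hq
      simp only [Finset.mem_filter, Finset.mem_product, Finset.mem_union, Finset.mem_diag,
        collisions] at hq ⊢
      tauto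
    refine (Finset.card_le_card hsub).trans ((Finset.card_union_le _ _).trans ?_)
    rw [Finset.diag_card]
  · rintro ⟨x, y⟩ hq
    simp only [Finset.coe_filter, Finset.mem_product, Set.mem_ofPred_eq] at hq
    simpa using hT x hq.1.1

/-- With at least `S.card` buckets there are at most `4 * S.card` collisions, so the squares of the
bucket sizes sum to at most `5 * S.card`. Quadratic space per bucket thus stays linear in total: `16
* 5` for the slots, `7 * 2` for headers and pointers of at most `2 * S.card` buckets, and `3` for
the top record. -/
theorem placeable_dict {w : ℕ} (hw : 1 ≤ w) {S : Finset ℕ} (hne : S.Nonempty) {f : ℕ → ℕ}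
    (hS : ∀ x ∈ S, x < 2 ^ w) (hf : ∀ x ∈ S, f x < 2 ^ w) :
    Placeable w (97 * S.card) (DictAt w fun x => if x ∈ S then f x else 0) := by
  apply Placeable.of_lt
  intro hlt
  have hn : 1 ≤ S.card := Finset.card_pos.2 hne
  obtain ⟨m, hm⟩ : ∃ m, m = Nat.clog 2 S.card := ⟨_, rfl⟩
  have hm1 : S.card ≤ 2 ^ m := hm ▸ Nat.le_pow_clog (by norm_num) _
  have hm2 : 2 ^ m ≤ 2 * S.card := hm ▸ two_pow_clog_le _ hn
  have hmw : m ≤ w := by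
    by_contra hcon
    have : 2 ^ w ≤ 2 ^ m := Nat.pow_le_pow_right (by norm_num) (by omega)
    omega
  obtain ⟨a, ha, hcol⟩ := exists_mulShift_collisions_le hw hmw hS
  have hcol' : (collisions S (mulShift w (w - m) a)).card ≤ 4 * S.card := by
    refine Nat.le_of_mul_le_mul_right (c := S.card) ?_ hn
    calc (collisions S (mulShift w (w - m) a)).card * S.card
        ≤ (collisions S (mulShift w (w - m) a)).card * 2 ^ m := Nat.mul_le_mul_left _ hm1
      _ ≤ 4 * S.card ^ 2 := hcol
      _ = 4 * S.card * S.card := by ring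
  have hwlt : w < 2 ^ w := Nat.lt_two_pow_self
  let part : ℕ → Finset ℕ := fun t => S.filter fun x => mulShift w (w - m) a x = t
  have hpart := sum_card_fiber_sq_le S (mulShift w (w - m) a) (T := 2 ^ m)
    fun x _ => mulShift_lt hmw
  have hb : ∀ t < 2 ^ m, Placeable w (16 * (part t).card ^ 2 + 6)
      (BucketAt w fun x => if x ∈ part t then f x else 0) := fun t _ =>
    placeable_bucket hw (fun x hx => hS x (Finset.mem_of_mem_filter x hx))
      fun x hx => hf x (Finset.mem_of_mem_filter x hx)
  refine (Placeable.consVal ha (Placeable.consVal (show w - m < 2 ^ w by omega)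
    (Placeable.consPtr (Placeable.ptrs hb) Placeable.trivial))).mono ?_ ?_
  · simp only [Finset.sum_add_distrib, Finset.sum_const, Finset.card_range, smul_eq_mul,
      ← Finset.mul_sum]
    simp only [part]
    omega
  · rintro mem p ⟨h0, h1, ⟨T, h2, h3⟩, -⟩
    refine ⟨a, w - m, T, h0, h1, h2, fun x _ => ?_⟩
    obtain ⟨q, hq, hbk⟩ := h3 _ (mulShift_lt (a := a) (x := x) hmw)
    refine ⟨q, _, hq, hbk, ?_⟩
    simp [part]

/-! ### Evaluation rules and the dictionary lookup. -/

namespace WordRAM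

namespace Exp

/-- The cell `i` places after the address `e`. -/
def cell (e i : Exp) : Exp := get (bin .add e i)

/-- The field with the number `k` of the record at the address `e`. -/
def field (e : Exp) (k : ℕ) : Exp := cell e (lit k)

variable {w : ℕ} {mem : ℕ → Option ℕ} {ρ : ℕ → ℕ} {a b e : Exp} {x y : ℕ}

theorem eval_var {r : ℕ} (h : ρ r = x) : (var r).eval w mem ρ = some x := by
  rw [eval, h]

theorem eval_lit {k : ℕ} (h : k < 2 ^ w) : (lit k).eval w mem ρ = some k := by
  rw [eval, Nat.mod_eq_of_lt h]

theorem eval_bin {o : Op} (ha : a.eval w mem ρ = some x) (hb : b.eval w mem ρ = some y) :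
    (bin o a b).eval w mem ρ = some (o.natEval w x y) := by
  simp [eval, ha, hb]

theorem eval_add (ha : a.eval w mem ρ = some x) (hb : b.eval w mem ρ = some y)
    (h : x + y < 2 ^ w) : (bin .add a b).eval w mem ρ = some (x + y) := by
  rw [eval_bin ha hb, Op.natEval, Nat.mod_eq_of_lt h]

theorem eval_sub (ha : a.eval w mem ρ = some x) (hb : b.eval w mem ρ = some y)
    (h : y ≤ x) (hx : x < 2 ^ w) : (bin .sub a b).eval w mem ρ = some (x - y) := by
  rw [eval_bin ha hb, Op.natEval, show 2 ^ w - y + x = (x - y) + 2 ^ w by omega,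
    Nat.add_mod_right, Nat.mod_eq_of_lt (by omega)]

theorem eval_mul (ha : a.eval w mem ρ = some x) (hb : b.eval w mem ρ = some y)
    (h : x * y < 2 ^ w) : (bin .mul a b).eval w mem ρ = some (x * y) := by
  rw [eval_bin ha hb, Op.natEval, Nat.mod_eq_of_lt h]

theorem eval_shl (ha : a.eval w mem ρ = some x) (hb : b.eval w mem ρ = some y)
    (h : x * 2 ^ y < 2 ^ w) : (bin .shl a b).eval w mem ρ = some (x * 2 ^ y) := by
  rw [eval_bin ha hb, Op.natEval, Nat.shiftLeft_eq, Nat.mod_eq_of_lt h]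

theorem eval_shr (ha : a.eval w mem ρ = some x) (hb : b.eval w mem ρ = some y) :
    (bin .shr a b).eval w mem ρ = some (x / 2 ^ y) := by
  rw [eval_bin ha hb, Op.natEval, Nat.shiftRight_eq_div_pow]

theorem eval_get (ha : a.eval w mem ρ = some x) (hx : mem x = some y) :
    (get a).eval w mem ρ = some y := by
  simp [eval, ha, hx]

end Exp

/-- Addresses and contents of the memory are words. -/
def MemWords (w : ℕ) (mem : ℕ → Option ℕ) : Prop :=
  ∀ a v, mem a = some v → a < 2 ^ w ∧ v < 2 ^ w

namespace Exp

variable {w : ℕ} {mem : ℕ → Option ℕ} {ρ : ℕ → ℕ} {e i : Exp} {p t v : ℕ}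

theorem eval_cell (hm : MemWords w mem) (he : e.eval w mem ρ = some p)
    (hi : i.eval w mem ρ = some t) (hv : mem (p + t) = some v) :
    (cell e i).eval w mem ρ = some v :=
  eval_get (eval_add he hi (hm _ _ hv).1) hv

theorem eval_field (hm : MemWords w mem) (he : e.eval w mem ρ = some p) {k : ℕ}
    (hv : mem (p + k) = some v) : (field e k).eval w mem ρ = some v :=
  eval_cell hm he (eval_lit (by have := (hm _ _ hv).1; omega)) hv

/-- The value of the multiply-shift hash function whose multiplier and shift are the first two
fields of the record at `e`. -/
def hash (e x : Exp) : Exp := bin .shr (bin .mul (field e 0) x) (field e 1)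

theorem eval_hash (hm : MemWords w mem) (he : e.eval w mem ρ = some p) {a sh x : ℕ}
    (hi : i.eval w mem ρ = some x) (ha : mem p = some a) (hsh : mem (p + 1) = some sh) :
    (hash e i).eval w mem ρ = some (mulShift w sh a x) :=
  eval_shr (eval_bin (eval_field (k := 0) hm he ha) hi) (eval_field hm he hsh)

end Exp

theorem Store.set_val (σ : Store) (r v r' : ℕ) :
    (σ.set r v).val r' = if r' = r then v else σ.val r' := by
  simp [Store.set, Function.update_apply]

theorem Store.set_out (σ : Store) (r v : ℕ) : (σ.set r v).out = σ.out := rfl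

/-- `σ'` has the same values as `σ` in the variables below `k`, and the same output. -/
def Store.Agree (k : ℕ) (σ σ' : Store) : Prop := (∀ r < k, σ'.val r = σ.val r) ∧ σ'.out = σ.out

theorem Store.Agree.refl (k : ℕ) (σ : Store) : Store.Agree k σ σ := ⟨fun _ _ => rfl, rfl⟩

theorem Store.Agree.trans {k : ℕ} {σ₁ σ₂ σ₃ : Store} (h₁ : Store.Agree k σ₁ σ₂)
    (h₂ : Store.Agree k σ₂ σ₃) : Store.Agree k σ₁ σ₃ :=
  ⟨fun r hr => (h₂.1 r hr).trans (h₁.1 r hr), h₂.2.trans h₁.2⟩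

theorem Store.Agree.mono {k k' : ℕ} {σ₁ σ₂ : Store} (h : Store.Agree k σ₁ σ₂) (hk : k' ≤ k) :
    Store.Agree k' σ₁ σ₂ :=
  ⟨fun r hr => h.1 r (hr.trans_le hk), h.2⟩

theorem Store.Agree.set {k r : ℕ} {σ₁ σ₂ : Store} (h : Store.Agree k σ₁ σ₂) (hr : k ≤ r) (v : ℕ) :
    Store.Agree k σ₁ (σ₂.set r v) :=
  ⟨fun r' hr' => by rw [Store.set_val, if_neg (by omega), h.1 r' hr'], h.2⟩

namespace Stmt

open Exp

/-- Look up the key in variable `21` in the dictionary whose address is in variable `20`, and put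
the result into variable `22`. -/
def lookup : Stmt :=
  .seq (.assign 23 (cell (field (var 20) 2) (hash (var 20) (var 21)))) <|
  .seq (.assign 24 (bin .add (bin .add (var 23) (lit 2)) (bin .mul (lit 2)
    (hash (var 23) (var 21))))) <|
  .ifLt (bin .xor (get (var 24)) (var 21)) (lit 1) (.assign 22 (field (var 24) 1))
    (.assign 22 (lit 0))

theorem wp_lookup {w K : ℕ} (hK : 0 < K) {mem : ℕ → Option ℕ} (hm : MemWords w mem) {f : ℕ → ℕ}
    {σ : Store} (hD : DictAt w f mem (σ.val 20)) (hx : σ.val 21 < 2 ^ w) :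
    WP w mem lookup K (fun σ' => σ'.val 22 = f (σ.val 21) ∧ Store.Agree 22 σ σ') σ := by
  obtain ⟨a, sh, T, ha, hsh, hT, hD⟩ := hD
  obtain ⟨q, g, hq, ⟨a', sh', ha', hsh', hB⟩, hg⟩ := hD _ hx
  obtain ⟨key, v, hkey, hv, hkv⟩ := hB _ hx
  have h1 := (hm _ _ hkey).1
  have h2 := (hm _ _ hkey).2
  refine .seq (.assign hK (v := q) ?_ ?_)
  · exact eval_cell hm (eval_field hm (eval_var rfl) hT)
      (eval_hash hm (eval_var rfl) (eval_var rfl) ha hsh) hq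
  refine .seq (.assign hK (v := q + 2 + 2 * mulShift w sh' a' (σ.val 21)) ?_ ?_)
  · have h23 : (var 23).eval w mem (σ.set 23 q).val = some q := eval_var (by simp [Store.set_val])
    exact eval_add (eval_add h23 (eval_lit (by omega)) (by omega))
      (eval_mul (eval_lit (by omega)) (eval_hash hm h23
        (eval_var (by simp [Store.set_val])) ha' hsh') (by omega)) h1
  have h24 : ∀ v, (var 24).eval w mem ((σ.set 23 q).set 24 v).val = some v :=
    fun v => eval_var (by simp [Store.set_val])
  -- The only test is `<`; two words are equal exactly if their `xor` is below `1`.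
  refine .ifLt hK (eval_bin (eval_get (h24 _) hkey) (eval_var (x := σ.val 21)
    (by simp [Store.set_val]))) (eval_lit (by omega)) (fun hlt => ?_) fun hlt => ?_
  · have hk : key = σ.val 21 := by
      rw [Nat.lt_one_iff] at hlt
      exact Nat.xor_eq_zero_iff.1 hlt
    refine .assign hK (eval_field hm (h24 _) hv) ⟨?_, ?_⟩
    · rw [Store.set_val, if_pos rfl, ← hg, ← hkv, if_pos hk]
    · exact (((Store.Agree.refl _ _).set (by norm_num) _).set (by norm_num) _).set le_rfl _
  · have hk : key ≠ σ.val 21 := by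
      intro hk
      apply hlt
      rw [hk, Op.natEval, Nat.xor_self]
      exact Nat.one_pos
    refine .assign hK (eval_lit (by omega)) ⟨?_, ?_⟩
    · rw [Store.set_val, if_pos rfl, ← hg, ← hkv, if_neg hk]
    · exact (((Store.Agree.refl _ _).set (by norm_num) _).set (by norm_num) _).set le_rfl _

end Stmt

end WordRAM

/-! Ranks. -/

/-- The number of elements of `S` that are at most `x`. -/
def rankIn (S : Finset ℕ) (x : ℕ) : ℕ := (S.filter fun y => y ≤ x).card

theorem rankIn_le_card (S : Finset ℕ) (x : ℕ) : rankIn S x ≤ S.card := Finset.card_filter_le _ _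

theorem rankIn_mono (S : Finset ℕ) {x y : ℕ} (h : x ≤ y) : rankIn S x ≤ rankIn S y :=
  Finset.card_le_card fun z hz => by
    simp only [Finset.mem_filter] at hz ⊢
    exact ⟨hz.1, hz.2.trans h⟩

theorem rankIn_eq_card {S : Finset ℕ} {x : ℕ} (h : ∀ y ∈ S, y ≤ x) : rankIn S x = S.card := by
  rw [rankIn, Finset.filter_true_of_mem h]

theorem rankIn_eq_count (S : Finset ℕ) (x : ℕ) : rankIn S x = Nat.count (· ∈ S) (x + 1) := by
  rw [Nat.count_eq_card_filter_range, rankIn]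
  congr 1
  ext y
  simp only [Finset.mem_filter, Finset.mem_range]
  constructor
  · rintro ⟨h1, h2⟩; exact ⟨by omega, h1⟩
  · rintro ⟨h1, h2⟩; exact ⟨h2, by omega⟩

/-- The `i`-th element of `S` in increasing order. -/
noncomputable def nthElem (S : Finset ℕ) (i : ℕ) : ℕ := Nat.nth (· ∈ S) i

theorem toFinset_mem (S : Finset ℕ) (hf : {x | x ∈ S}.Finite) : hf.toFinset = S := by
  ext x
  rw [Set.Finite.mem_toFinset]
  exact Iff.rfl

theorem nthElem_mem {S : Finset ℕ} {i : ℕ} (hi : i < S.card) : nthElem S i ∈ S :=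
  Nat.nth_mem (p := (· ∈ S)) i fun hf => by rwa [toFinset_mem]

theorem count_nthElem {S : Finset ℕ} {i : ℕ} (hi : i < S.card) :
    Nat.count (· ∈ S) (nthElem S i) = i :=
  Nat.count_nth (p := (· ∈ S)) fun hf => by rwa [toFinset_mem]

theorem rankIn_nthElem {S : Finset ℕ} {i : ℕ} (hi : i < S.card) : rankIn S (nthElem S i) = i + 1 := by
  rw [rankIn_eq_count, Nat.count_succ, count_nthElem hi, if_pos (nthElem_mem hi)]

/-- This exchanges comparisons of array entries with `x` for comparisons of indices with the rank of
`x`, as needed for sampling and for binary search. -/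
theorem nthElem_le_iff {S : Finset ℕ} {i : ℕ} (hi : i < S.card) (x : ℕ) :
    nthElem S i ≤ x ↔ i < rankIn S x := by
  constructor
  · intro h
    have := rankIn_mono S h
    rw [rankIn_nthElem hi] at this
    omega
  · intro h
    by_contra! hlt
    have := Nat.count_monotone (· ∈ S) (show x + 1 ≤ nthElem S i from hlt)
    rw [count_nthElem hi, ← rankIn_eq_count] at this
    omega

/-! Nodes of the binary trie of all words, numbered in inorder. -/

/-- The ancestor of the leaf `x` at height `e + 1`. -/
def trieNode (x e : ℕ) : ℕ := (2 * (x / 2 ^ (e + 1)) + 1) * 2 ^ e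

theorem trieNode_pos (x e : ℕ) : 0 < trieNode x e := by
  unfold trieNode
  positivity

theorem trieNode_lt {w x e : ℕ} (hx : x < 2 ^ w) (he : e < w) : trieNode x e < 2 ^ w := by
  obtain ⟨d, rfl⟩ : ∃ d, w = d + (e + 1) := ⟨w - (e + 1), by omega⟩
  unfold trieNode
  have h1 : x / 2 ^ (e + 1) < 2 ^ d := by
    rw [Nat.div_lt_iff_lt_mul (by positivity), ← pow_add]
    exact hx
  calc (2 * (x / 2 ^ (e + 1)) + 1) * 2 ^ e < 2 * 2 ^ d * 2 ^ e :=
        Nat.mul_lt_mul_of_pos_right (by omega) (by positivity)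
    _ = 2 ^ (d + (e + 1)) := by ring

/-- In inorder numbering a node of height `e + 1` is the first leaf of its right half. Whatever lies
between `x` and this point is in the same half as `x`, that is, below the same node of height `e`.
-/
theorem div_eq_of_between_trieNode {x y e : ℕ}
    (h : x < y ∧ y < trieNode x e ∨ trieNode x e ≤ y ∧ y < x) : y / 2 ^ e = x / 2 ^ e := by
  have hx : x / 2 ^ (e + 1) = x / 2 ^ e / 2 := by rw [pow_succ, Nat.div_div_eq_div_mul]
  unfold trieNode at h
  rw [hx] at h
  have hp : 0 < 2 ^ e := by positivity
  rcases h with ⟨h1, h2⟩ | ⟨h1, h2⟩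
  · have h3 := (Nat.div_lt_iff_lt_mul hp).2 h2
    have h4 := Nat.div_le_div_right (c := 2 ^ e) h1.le
    omega
  · have h3 := (Nat.le_div_iff_mul_le hp).2 h1
    have h4 := Nat.div_le_div_right (c := 2 ^ e) h2.le
    omega

/-- The nodes of the trie that are stored: the ancestors of every `L`-th element of `S`, and the
root. -/
noncomputable def sampledNodes (L : ℕ) (S : Finset ℕ) : Finset ℕ :=
  insert (trieNode 0 (L - 1)) ((Finset.range (S.card / L) ×ˢ Finset.range L).image fun q =>
    trieNode (nthElem S ((q.1 + 1) * L - 1)) q.2)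

/-- What is stored with the nodes: one more than the number of sampled elements below the node,
and `0` for a node that is not stored. -/
noncomputable def nodeValue (L : ℕ) (S : Finset ℕ) (v : ℕ) : ℕ :=
  if v ∈ sampledNodes L S then rankIn S (v - 1) / L + 1 else 0

/-- Sampling pays for the trie: `S.card / L` elements with `L` ancestors each, and the root. -/
theorem card_sampledNodes_le (L : ℕ) (S : Finset ℕ) : (sampledNodes L S).card ≤ S.card + 1 := by
  refine (Finset.card_insert_le _ _).trans (Nat.succ_le_succ (Finset.card_image_le.trans ?_))
  rw [Finset.card_product, Finset.card_range, Finset.card_range]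
  exact Nat.div_mul_le_self _ _

theorem nodeValue_root_ne_zero {L x : ℕ} (hL : 1 ≤ L) (hx : x < 2 ^ L) (S : Finset ℕ) :
    nodeValue L S (trieNode x (L - 1)) ≠ 0 := by
  have h : trieNode x (L - 1) = trieNode 0 (L - 1) := by
    unfold trieNode
    rw [Nat.sub_add_cancel hL, Nat.div_eq_of_lt hx, Nat.zero_div]
  rw [nodeValue, if_pos]
  · exact Nat.succ_ne_zero _
  · rw [h]
    exact Finset.mem_insert_self _ _

theorem index_lt {n L q : ℕ} (hL : 1 ≤ L) (hq : q < n / L) : (q + 1) * L - 1 < n := by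
  have h1 : (q + 1) * L ≤ n / L * L := Nat.mul_le_mul_right _ hq
  have h2 := Nat.div_mul_le_self n L
  have h3 : 1 ≤ (q + 1) * L := Nat.mul_pos (by omega) hL
  omega

/-- Let `v` be the stored node above `x` whose child towards `x` is absent. No sample lies in that
half of `v`, so `x` and `v` have the same samples on either side. If `q` samples are below `v`, the
`q`-th one is at most `x`, and the next, if it exists, is at least `x`; their ranks are `q * L` and
`(q + 1) * L`. -/
theorem rank_bracket {L x e : ℕ} (hL : 1 ≤ L) {S : Finset ℕ} (he : e < L)
    (h0 : e = 0 ∨ nodeValue L S (trieNode x (e - 1)) = 0)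
    (h1 : nodeValue L S (trieNode x e) ≠ 0) :
    (nodeValue L S (trieNode x e) - 1) * L ≤ rankIn S x ∧
      rankIn S x ≤ (nodeValue L S (trieNode x e) - 1) * L + L := by
  have hsep : ∀ q < S.card / L, ¬ (x < nthElem S ((q + 1) * L - 1) ∧
      nthElem S ((q + 1) * L - 1) < trieNode x e ∨ trieNode x e ≤ nthElem S ((q + 1) * L - 1) ∧
        nthElem S ((q + 1) * L - 1) < x) := by
    intro q hq h
    -- A sample between `x` and the node would be `x` itself if `e = 0`, and otherwise would have
    -- the absent child as a stored ancestor.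
    have hdiv := div_eq_of_between_trieNode h
    rcases Nat.eq_zero_or_pos e with rfl | hpos
    · simp only [pow_zero, Nat.div_one] at hdiv
      omega
    · obtain ⟨s, rfl⟩ : ∃ s, e = s + 1 := ⟨e - 1, by omega⟩
      rcases h0 with h0 | h0
      · omega
      · rw [Nat.add_sub_cancel, nodeValue, if_pos] at h0
        · exact Nat.succ_ne_zero _ h0
        · refine Finset.mem_insert_of_mem (Finset.mem_image.2 ⟨(q, s), ?_, ?_⟩)
          · simp only [Finset.mem_product, Finset.mem_range]
            omega
          · simp only [trieNode, hdiv]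
  generalize hv : trieNode x e = v at *
  have hvpos : 0 < v := hv ▸ trieNode_pos x e
  unfold nodeValue at h1 ⊢
  split_ifs at h1 ⊢ with hmem
  swap
  · exact absurd rfl h1
  rw [Nat.add_sub_cancel]
  have hr := Nat.div_add_mod (rankIn S (v - 1)) L
  have hr' := Nat.mod_lt (rankIn S (v - 1)) (show L > 0 from hL)
  have hrn := rankIn_le_card S (v - 1)
  have hqn : rankIn S (v - 1) / L ≤ S.card / L := Nat.div_le_div_right hrn
  generalize hq : rankIn S (v - 1) / L = q at *
  rw [Nat.mul_comm] at hr
  constructor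
  · rcases Nat.eq_zero_or_pos q with rfl | hpos
    · simp
    · obtain ⟨q, rfl⟩ : ∃ k, q = k + 1 := ⟨q - 1, by omega⟩
      have hlt := index_lt hL (show q < S.card / L by omega)
      have hpos' : 1 ≤ (q + 1) * L := Nat.mul_pos (by omega) hL
      have h2 := (nthElem_le_iff hlt (v - 1)).2 (by omega)
      have h3 : nthElem S ((q + 1) * L - 1) ≤ x := by
        by_contra hcon
        exact hsep q (by omega) (Or.inl ⟨by omega, by omega⟩)
      have h4 := (nthElem_le_iff hlt x).1 h3
      omega
  · by_cases hlt : q < S.card / L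
    · have hi := index_lt hL hlt
      have hexp : (q + 1) * L = q * L + L := by ring
      have h2 : ¬ nthElem S ((q + 1) * L - 1) ≤ v - 1 := by
        rw [nthElem_le_iff hi]
        omega
      have h3 : x ≤ nthElem S ((q + 1) * L - 1) := by
        by_contra hcon
        exact hsep q hlt (Or.inr ⟨by omega, by omega⟩)
      have h4 := rankIn_mono S h3
      rw [rankIn_nthElem hi] at h4
      omega
    -- There is no further sample, so fewer than `L` elements follow the last one.
    · have h2 := rankIn_le_card S x
      have h3 := Nat.div_add_mod S.card L
      have h4 := Nat.mod_lt S.card (show L > 0 from hL)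
      rw [show S.card / L = q by omega, Nat.mul_comm] at h3
      omega

/-! ### The rank structure and its size. -/

/-- A data structure for the rank function of `S`. -/
def RankAt (w L : ℕ) (S : Finset ℕ) (mem : ℕ → Option ℕ) (p : ℕ) : Prop :=
  ∃ M T D, mem p = some M ∧ mem (p + 1) = some S.card ∧ mem (p + 2) = some L ∧
    mem (p + 3) = some T ∧ mem (p + 4) = some D ∧ (∀ y ∈ S, y ≤ M) ∧ M < 2 ^ L ∧
    (∀ i < S.card, mem (T + i) = some (nthElem S i)) ∧ DictAt w (nodeValue L S) mem D

theorem placeable_rank {w L : ℕ} (hL : 1 ≤ L) (hLw : L ≤ w) {S : Finset ℕ} (hne : S.Nonempty)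
    (hS : ∀ x ∈ S, x < 2 ^ L) : Placeable w (200 * S.card) (RankAt w L S) := by
  apply Placeable.of_lt
  intro hlt
  have hn : 1 ≤ S.card := Finset.card_pos.2 hne
  have hpow : 2 ^ L ≤ 2 ^ w := Nat.pow_le_pow_right (by norm_num) hLw
  have hSw : ∀ x ∈ S, x < 2 ^ w := fun x hx => (hS x hx).trans_le hpow
  have hwlt : w < 2 ^ w := Nat.lt_two_pow_self
  have hK := card_sampledNodes_le L S
  have hnode : ∀ v ∈ sampledNodes L S, v < 2 ^ w := by
    intro v hv
    rw [sampledNodes, Finset.mem_insert, Finset.mem_image] at hv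
    rcases hv with rfl | ⟨⟨q, e⟩, hq, rfl⟩
    · exact trieNode_lt (by positivity) (by omega)
    · simp only [Finset.mem_product, Finset.mem_range] at hq
      exact trieNode_lt (hSw _ (nthElem_mem (index_lt hL hq.1))) (by omega)
  have hval : ∀ v ∈ sampledNodes L S, rankIn S (v - 1) / L + 1 < 2 ^ w := by
    intro v _
    have := rankIn_le_card S (v - 1)
    have := Nat.div_le_self (rankIn S (v - 1)) L
    omega
  have hdict := placeable_dict (S := sampledNodes L S) (by omega) ⟨_, Finset.mem_insert_self _ _⟩
    hnode hval
  have htab : ∀ i < S.card, nthElem S i < 2 ^ w := fun i hi => hSw _ (nthElem_mem hi)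
  refine (Placeable.consVal (hSw _ (S.max'_mem hne)) (Placeable.consVal (show S.card < 2 ^ w by omega)
    (Placeable.consVal (show L < 2 ^ w by omega) (Placeable.consPtr (Placeable.table htab)
      (Placeable.consPtr hdict Placeable.trivial))))).mono (by omega) ?_
  rintro mem p ⟨h0, h1, h2, ⟨T, h3, hT⟩, ⟨D, h4, hD⟩, -⟩
  exact ⟨_, T, D, h0, h1, h2, h3, h4, fun y hy => S.le_max' y hy, hS _ (S.max'_mem hne), hT, hD⟩

/-! ### Rank queries. -/

namespace WordRAM.Stmt

open Exp

/-- Put the trie node above `x` (in variable `11`) at the height given by variable `r` into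
variable `21`, and look it up. -/
def findNode (r : ℕ) : Stmt :=
  .seq (.assign 21 (bin .shl (bin .add (bin .mul (lit 2) (bin .shr (var 11) (var r))) (lit 1))
    (bin .sub (var r) (lit 1)))) lookup

theorem wp_findNode {w K : ℕ} (hK : 0 < K) {mem : ℕ → Option ℕ} (hm : MemWords w mem) {f : ℕ → ℕ}
    {σ : Store} (hD : DictAt w f mem (σ.val 20)) (hw : 2 ≤ w) (hx : σ.val 11 < 2 ^ w) {r e : ℕ} (hre : σ.val r = e + 1) (he : e < w) :
    WP w mem (findNode r) K
      (fun σ' => σ'.val 22 = f (trieNode (σ.val 11) e) ∧ Store.Agree 21 σ σ') σ := by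
  have hw4 : 2 ^ 2 ≤ 2 ^ w := Nat.pow_le_pow_right (by norm_num) hw
  have hwlt : w < 2 ^ w := Nat.lt_two_pow_self
  have hlt := trieNode_lt hx he
  have hle : 2 * (σ.val 11 / 2 ^ (e + 1)) + 1 ≤ trieNode (σ.val 11) e :=
    Nat.le_mul_of_pos_right _ (by positivity)
  refine .seq (.assign hK (v := trieNode (σ.val 11) e) ?_ ?_)
  · refine eval_shl (y := e) (eval_add (eval_mul (eval_lit (by omega)) (eval_shr (eval_var rfl)
      (eval_var hre)) (by omega)) (eval_lit (by omega)) (by omega)) ?_ hlt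
    exact eval_sub (eval_var hre) (eval_lit (by omega)) (by omega) (by omega)
  · refine (wp_lookup hK hm (f := f) ?_ ?_).mono le_rfl ?_
    · simpa [Store.set_val] using hD
    · simpa [Store.set_val] using hlt
    · rintro σ' ⟨h1, h2⟩
      refine ⟨by simpa [Store.set_val] using h1, ?_⟩
      exact ((Store.Agree.refl _ _).set le_rfl _).trans (h2.mono (by norm_num))

/-- Narrow down the height of the lowest stored node above `x` between the variables `13`
and `14`. -/
def searchHeight : Stmt :=
  .whileLt (bin .add (var 13) (lit 1)) (var 14) <|
    .seq (.assign 15 (bin .shr (bin .add (var 13) (var 14)) (lit 1))) <|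
    .seq (findNode 15) <|
    .ifLt (lit 0) (var 22) (.assign 14 (var 15)) (.assign 13 (var 15))

/-- Variables `13` and `14` are heights counted from `1`: the node at the upper one is stored, the
node at the lower one is not, and `0` stands for a place below all nodes. The search starts from the
root, which is always stored, and ends at adjacent heights; it needs no monotonicity of being
stored. -/
theorem wp_searchHeight {w L K : ℕ} (hK : 0 < K) {mem : ℕ → Option ℕ} (hm : MemWords w mem)
    {f : ℕ → ℕ} {σ : Store} (hw : 4 ≤ w) (hL : 1 ≤ L) (hLw : L ≤ w)
    (hD : DictAt w f mem (σ.val 20)) (hx : σ.val 11 < 2 ^ w) (hroot : f (trieNode (σ.val 11) (L - 1)) ≠ 0)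
    (h13 : σ.val 13 = 0) (h14 : σ.val 14 = L) :
    WP w mem searchHeight (K * (Nat.clog 2 L + 1)) (fun σ' => ∃ e < L, σ'.val 14 = e + 1 ∧
      (e = 0 ∨ f (trieNode (σ.val 11) (e - 1)) = 0) ∧ f (trieNode (σ.val 11) e) ≠ 0 ∧
      σ'.val 20 = σ.val 20 ∧ Store.Agree 12 σ σ') σ := by
  have hw2 : 2 * w < 2 ^ w := by
    obtain ⟨v, rfl⟩ : ∃ v, w = v + 4 := ⟨w - 4, by omega⟩
    have : v < 2 ^ v := Nat.lt_two_pow_self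
    rw [pow_add]
    omega
  refine .whileLt hK (fun n σ' => ∃ lo hi, σ'.val 13 = lo ∧ σ'.val 14 = hi ∧ lo < hi ∧ hi ≤ L ∧
    hi - lo ≤ 2 ^ n ∧ (lo = 0 ∨ f (trieNode (σ.val 11) (lo - 1)) = 0) ∧
    f (trieNode (σ.val 11) (hi - 1)) ≠ 0 ∧ σ'.val 20 = σ.val 20 ∧ Store.Agree 12 σ σ') ?_ _ ?_
  · rintro n τ ⟨lo, hi, hlo, hhi, hlt, hle, hn, hflo, hfhi, h20, hag⟩
    refine ⟨lo + 1, hi, eval_add (eval_var hlo) (eval_lit (by omega)) (by omega), eval_var hhi,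
      fun hc => ?_, fun hc => ?_⟩
    · cases n with
      | zero => omega
      | succ n =>
        refine ⟨n, rfl, ?_⟩
        rw [pow_succ] at hn
        refine .seq (.assign hK (v := (lo + hi) / 2 ^ 1) (eval_shr (eval_add (eval_var hlo)
          (eval_var hhi) (by omega)) (eval_lit (by omega))) ?_)
        -- The loop test `lo + 1 < hi` makes the midpoint positive, so it names a node.
        obtain ⟨e, he⟩ : ∃ e, (lo + hi) / 2 ^ 1 = e + 1 := ⟨(lo + hi) / 2 - 1, by omega⟩
        rw [he]
        have h11 : τ.val 11 = σ.val 11 := hag.1 11 (by norm_num)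
        refine .seq ((wp_findNode (f := f) (e := e) hK hm ?_ (by omega) ?_ ?_
          (by omega)).mono le_rfl ?_)
        · simpa [Store.set_val, h20] using hD
        · simpa [Store.set_val, h11] using hx
        · simp [Store.set_val]
        · rintro ρ ⟨hρ, hagρ⟩
          have hv : ∀ r < 21, r ≠ 15 → ρ.val r = τ.val r := fun r hr hne => by
            rw [hagρ.1 r hr, Store.set_val, if_neg hne]
          have h15 : ρ.val 15 = e + 1 := by
            rw [hagρ.1 15 (by norm_num), Store.set_val, if_pos rfl]
          have hagτ : Store.Agree 12 σ ρ :=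
            (hag.set (by norm_num) _).trans (hagρ.mono (by norm_num))
          simp only [Store.set_val, h11] at hρ
          refine .ifLt hK (eval_lit (by omega)) (eval_var hρ) (fun hpos => ?_) fun hpos => ?_
          · refine .assign hK (eval_var h15) ⟨lo, e + 1, ?_, ?_, by omega, by omega, by omega, hflo,
              ?_, ?_, hagτ.set (by norm_num) _⟩
            · simp [Store.set_val, hv, hlo]
            · simp [Store.set_val]
            · simp only [Nat.add_sub_cancel]
              simp at hpos
              omega
            · simp [Store.set_val, hv, h20]
          · refine .assign hK (eval_var h15) ⟨e + 1, hi, ?_, ?_, by omega, by omega, by omega, ?_,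
              hfhi, ?_, hagτ.set (by norm_num) _⟩
            · simp [Store.set_val]
            · simp [Store.set_val, hv, hhi]
            · right
              simp only [Nat.add_sub_cancel]
              simp at hpos
              omega
            · simp [Store.set_val, hv, h20]
    · obtain rfl : hi = lo + 1 := by omega
      exact ⟨lo, by omega, hhi, hflo, hfhi, h20, hag⟩
  · exact ⟨0, L, h13, h14, hL, le_rfl, by simpa using Nat.le_pow_clog (by norm_num) L, Or.inl rfl,
      hroot, rfl, Store.Agree.refl _ _⟩

/-- Binary search for the rank of variable `11` between the variables `13` and `14`, in the sorted
array of the rank structure in variable `10`. -/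
def searchArray : Stmt :=
  .whileLt (var 13) (var 14) <|
    .seq (.assign 15 (bin .shr (bin .add (var 13) (var 14)) (lit 1))) <|
    .ifLt (var 11) (cell (field (var 10) 3) (var 15)) (.assign 14 (var 15))
      (.assign 13 (bin .add (var 15) (lit 1)))

theorem wp_searchArray {w T m K : ℕ} (hK : 0 < K) {mem : ℕ → Option ℕ} (hm : MemWords w mem)
    {S : Finset ℕ} {σ : Store} (hn : 2 * S.card + 1 < 2 ^ w) (hT : mem (σ.val 10 + 3) = some T)
    (hA : ∀ i < S.card, mem (T + i) = some (nthElem S i))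
    (h13 : σ.val 13 ≤ rankIn S (σ.val 11)) (h14 : rankIn S (σ.val 11) ≤ σ.val 14)
    (hcard : σ.val 14 ≤ S.card) (hd : σ.val 14 - σ.val 13 < 2 ^ m) :
    WP w mem searchArray (K * (m + 1)) (fun σ' => σ'.val 13 = rankIn S (σ.val 11) ∧
      Store.Agree 12 σ σ') σ := by
  refine .whileLt hK (fun n σ' => ∃ lo hi, σ'.val 13 = lo ∧ σ'.val 14 = hi ∧
    lo ≤ rankIn S (σ.val 11) ∧ rankIn S (σ.val 11) ≤ hi ∧ hi ≤ S.card ∧ hi - lo < 2 ^ n ∧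
    Store.Agree 12 σ σ') ?_ _ ⟨_, _, rfl, rfl, h13, h14, hcard, hd, Store.Agree.refl _ _⟩
  rintro n τ ⟨lo, hi, hlo, hhi, hle₁, hle₂, hc, hn', hag⟩
  refine ⟨lo, hi, eval_var hlo, eval_var hhi, fun hlt => ?_, fun hge => ⟨by omega, hag⟩⟩
  cases n with
  | zero =>
    rw [pow_zero] at hn'
    omega
  | succ n =>
    refine ⟨n, rfl, ?_⟩
    rw [pow_succ] at hn'
    have hcell := hA ((lo + hi) / 2) (by omega)
    have hiff := nthElem_le_iff (S := S) (i := (lo + hi) / 2) (by omega) (σ.val 11)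
    refine .seq (.assign hK (v := (lo + hi) / 2 ^ 1) (eval_shr (eval_add (eval_var hlo)
      (eval_var hhi) (by omega)) (eval_lit (by omega))) ?_)
    rw [pow_one]
    have hmid : 2 * ((lo + hi) / 2) ≤ lo + hi ∧ lo + hi ≤ 2 * ((lo + hi) / 2) + 1 := by omega
    generalize (lo + hi) / 2 = mid at *
    have h15 : ∀ r v, (τ.set r v).val r = v := fun r v => by simp [Store.set_val]
    have hag' : Store.Agree 12 σ (τ.set 15 mid) := hag.set (by norm_num) _
    refine .ifLt hK (eval_var (hag'.1 11 (by norm_num))) (eval_cell hm (eval_field hm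
      (eval_var (hag'.1 10 (by norm_num))) hT) (eval_var (h15 _ _)) hcell)
      (fun hl => ?_) fun hl => ?_
    · refine .assign hK (eval_var (h15 _ _)) ⟨lo, mid, ?_, ?_, ?_, ?_, ?_, ?_,
        hag'.set (by norm_num) _⟩
      · simp [Store.set_val, hlo]
      · simp [Store.set_val]
      all_goals omega
    · refine .assign hK (eval_add (eval_var (h15 _ _)) (eval_lit (by omega)) (by omega))
        ⟨mid + 1, hi, ?_, ?_, ?_, ?_, ?_, ?_, hag'.set (by norm_num) _⟩
      · simp [Store.set_val]
      · simp [Store.set_val, hhi]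
      all_goals omega

/-- Put the rank of variable `11` in the set of the rank structure in variable `10` into
variable `12`. -/
def rankLe : Stmt :=
  .ifLt (var 11) (field (var 10) 0)
    (.seq (.assign 13 (lit 0)) <|
     .seq (.assign 14 (field (var 10) 2)) <|
     .seq (.assign 20 (field (var 10) 4)) <|
     .seq searchHeight <|
     .seq (findNode 14) <|
     .seq (.assign 13 (bin .mul (bin .sub (var 22) (lit 1)) (field (var 10) 2))) <|
     .seq (.assign 14 (bin .add (var 13) (field (var 10) 2))) <|
     .seq (.ifLt (var 14) (field (var 10) 1) (.assign 14 (var 14))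
       (.assign 14 (field (var 10) 1))) <|
     .seq searchArray <|
     .assign 12 (var 13))
    (.assign 12 (field (var 10) 1))

/-- Arguments from the maximum `M` on are answered by the cardinality. All others are below `2 ^ L`,
so the trie needs only `L` levels although queries are arbitrary words. Both binary searches have
logarithmically many rounds in `L`: over the heights, and over a bracket of length at most `L`. The
bounds `hn` keep bracket ends and midpoint sums from wrapping around. -/
theorem wp_rankLe {w L : ℕ} (hw : 4 ≤ w) (hL : 1 ≤ L) (hLw : L ≤ w) {mem : ℕ → Option ℕ}
    (hm : MemWords w mem) {S : Finset ℕ} (hn : S.card + w < 2 ^ w ∧ 2 * S.card + 1 < 2 ^ w)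
    {σ : Store} (hp : RankAt w L S mem (σ.val 10)) :
    WP w mem rankLe (Nat.clog 2 L + 2)
      (fun σ' => σ'.val 12 = rankIn S (σ.val 11) ∧ Store.Agree 12 σ σ') σ := by
  obtain ⟨M, T, D, h0, h1, h2, h3, h4, hM, hML, hT, hD⟩ := hp
  have hK : 0 < Nat.clog 2 L + 2 := by omega
  have hag := Store.Agree.refl 12 σ
  have hx : ∀ τ, Store.Agree 12 σ τ → τ.val 11 = σ.val 11 := fun τ h => h.1 11 (by norm_num)
  have hp : ∀ τ, Store.Agree 12 σ τ → (var 10).eval w mem τ.val = some (σ.val 10) :=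
    fun τ h => eval_var (h.1 10 (by norm_num))
  have hlit : ∀ {τ : Store} {k}, k ≤ 4 → (lit k).eval w mem τ.val = some k :=
    fun hk => eval_lit (by omega)
  have hpow : 2 ^ L ≤ 2 ^ w := Nat.pow_le_pow_right (by norm_num) hLw
  refine .ifLt hK (eval_var rfl) (eval_field (k := 0) hm (hp σ hag) h0) (fun hlt => ?_) fun hge => ?_
  swap
  · refine .assign hK (eval_field hm (hp σ hag) h1) ⟨?_, hag.set le_rfl _⟩
    rw [Store.set_val, if_pos rfl, rankIn_eq_card fun y hy => (hM y hy).trans (by omega)]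
  refine .seq (.assign hK (hlit (by norm_num)) ?_)
  have hag := hag.set (r := 13) (by norm_num) 0
  refine .seq (.assign hK (eval_field hm (hp _ hag) h2) ?_)
  have hag := hag.set (r := 14) (by norm_num) L
  refine .seq (.assign hK (eval_field hm (hp _ hag) h4) ?_)
  have hag := hag.set (r := 20) (by norm_num) D
  generalize hτ : ((σ.set 13 0).set 14 L).set 20 D = τ at *
  refine .seq ((wp_searchHeight (f := nodeValue L S) (L := L) Nat.one_pos hm hw hL hLw ?_ ?_ ?_ ?_
    ?_).mono (by omega) ?_)
  · simpa [← hτ, Store.set_val] using hD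
  · rw [hx τ hag]
    omega
  · exact nodeValue_root_ne_zero hL (by rw [hx τ hag]; omega) _
  · simp [← hτ, Store.set_val]
  · simp [← hτ, Store.set_val]
  rintro τ₁ ⟨e, he, h14, habs, hpres, h20, hag₁⟩
  rw [hx τ hag] at habs hpres
  have hag := hag.trans hag₁
  have hbr := rank_bracket hL he habs hpres
  refine .seq ((wp_findNode (f := nodeValue L S) (e := e) hK hm ?_ (by omega) ?_ h14
    (by omega)).mono le_rfl ?_)
  · rw [h20]
    simpa [← hτ, Store.set_val] using hD
  · rw [hx _ hag]
    omega
  rintro τ₂ ⟨h22, hag₂⟩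
  rw [hx _ hag] at h22
  have hag := hag.trans (hag₂.mono (by norm_num))
  have hrn := rankIn_le_card S (σ.val 11)
  generalize nodeValue L S (trieNode (σ.val 11) e) = v at *
  have hvn : v - 1 ≤ S.card :=
    (Nat.le_mul_of_pos_right _ (show 0 < L from hL)).trans (hbr.1.trans hrn)
  refine .seq (.assign hK (eval_mul (eval_sub (eval_var h22) (hlit (by norm_num)) (by omega)
    (by omega)) (eval_field hm (hp _ hag) h2) (by omega)) ?_)
  have hag := hag.set (r := 13) (by norm_num) ((v - 1) * L)
  refine .seq (.assign hK (eval_add (eval_var (x := (v - 1) * L) (by simp [Store.set_val]))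
    (eval_field hm (hp _ hag) h2) (by omega)) ?_)
  have hag := hag.set (r := 14) (by norm_num) ((v - 1) * L + L)
  generalize hτ₃ : (τ₂.set 13 ((v - 1) * L)).set 14 ((v - 1) * L + L) = τ₃ at *
  have h13 : τ₃.val 13 = (v - 1) * L := by simp [← hτ₃, Store.set_val]
  have h14 : τ₃.val 14 = (v - 1) * L + L := by simp [← hτ₃, Store.set_val]
  have hrest : ∀ hi, rankIn S (σ.val 11) ≤ hi → hi ≤ S.card → hi ≤ (v - 1) * L + L →
      WP w mem (.seq searchArray <| .assign 12 (var 13)) (Nat.clog 2 L + 2)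
        (fun σ' => σ'.val 12 = rankIn S (σ.val 11) ∧ Store.Agree 12 σ σ') (τ₃.set 14 hi) := by
    intro hi h5 h6 h7
    have hag := hag.set (r := 14) (by norm_num) hi
    have hlog : L ≤ 2 ^ Nat.clog 2 L := Nat.le_pow_clog (by norm_num) L
    have hlog' : L < 2 ^ (Nat.clog 2 L + 1) := by
      rw [pow_succ]
      omega
    refine .seq ((wp_searchArray (S := S) (T := T) (m := Nat.clog 2 L + 1) Nat.one_pos hm hn.2
      ?_ hT ?_ ?_ ?_ ?_).mono (by omega) ?_)
    · rwa [hag.1 10 (by norm_num)]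
    · rw [hx _ hag]
      simpa [Store.set_val, h13] using hbr.1
    · rw [hx _ hag]
      simpa [Store.set_val] using h5
    · simpa [Store.set_val] using h6
    · have h8 : (τ₃.set 14 hi).val 14 = hi := by simp [Store.set_val]
      have h9 : (τ₃.set 14 hi).val 13 = (v - 1) * L := by simp [Store.set_val, h13]
      rw [h8, h9]
      omega
    · rintro τ₄ ⟨h13, hag₄⟩
      rw [hx _ hag] at h13
      refine .assign hK (eval_var h13) ⟨by simp [Store.set_val], ?_⟩
      exact (hag.trans hag₄).set le_rfl _
  refine .seq (.ifLt hK (eval_var h14) (eval_field hm (hp _ hag) h1) (fun hl => ?_) fun hl => ?_)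
  · exact .assign hK (eval_var h14) (hrest _ hbr.2 (by omega) le_rfl)
  · exact .assign hK (eval_field hm (hp _ hag) h1) (hrest _ hrn le_rfl (by omega))

end WordRAM.Stmt

/-! ### Counting points in intervals by ranks. -/

theorem nthElem_injOn {S : Finset ℕ} {i j : ℕ} (hi : i < S.card) (hj : j < S.card)
    (h : nthElem S i = nthElem S j) : i = j := by
  have := rankIn_nthElem hi
  rw [h, rankIn_nthElem hj] at this
  omega

theorem exists_nthElem_eq {S : Finset ℕ} {x : ℕ} (hx : x ∈ S) :
    ∃ i < S.card, nthElem S i = x := by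
  refine ⟨Nat.count (· ∈ S) x, ?_, Nat.nth_count (p := (· ∈ S)) hx⟩
  have h := rankIn_le_card S x
  rw [rankIn_eq_count, Nat.count_succ, if_pos hx] at h
  exact h

/-- The number of elements of `S` below `x`. -/
def rankLt (S : Finset ℕ) (x : ℕ) : ℕ := (S.filter fun y => y < x).card

theorem rankLt_zero (S : Finset ℕ) : rankLt S 0 = 0 := by
  simp [rankLt]

theorem rankIn_sub_one (S : Finset ℕ) {x : ℕ} (hx : 0 < x) : rankIn S (x - 1) = rankLt S x := by
  unfold rankIn rankLt
  congr 1
  ext y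
  simp only [Finset.mem_filter]
  constructor
  · rintro ⟨h, h'⟩; exact ⟨h, by omega⟩
  · rintro ⟨h, h'⟩; exact ⟨h, by omega⟩

theorem rankLt_le_rankIn (S : Finset ℕ) {a b : ℕ} (h : a ≤ b) : rankLt S a ≤ rankIn S b :=
  Finset.card_le_card fun y hy => by
    simp only [Finset.mem_filter] at hy ⊢
    exact ⟨hy.1, by omega⟩

theorem rankIn_le_rankLt (S : Finset ℕ) {a b : ℕ} (h : b < a) : rankIn S b ≤ rankLt S a :=
  Finset.card_le_card fun y hy => by
    simp only [Finset.mem_filter] at hy ⊢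
    exact ⟨hy.1, by omega⟩

theorem card_pointsIn (S : Finset ℕ) (a b : ℕ) :
    (pointsIn S a b).card = rankIn S b - rankLt S a := by
  rcases le_or_gt a b with h | h
  · rw [rankIn, rankLt, ← Finset.card_sdiff_of_subset]
    · congr 1
      ext y
      simp only [pointsIn, Finset.mem_filter, Finset.mem_sdiff]
      constructor
      · rintro ⟨h1, h2, h3⟩; exact ⟨⟨h1, h3⟩, fun h4 => by omega⟩
      · rintro ⟨⟨h1, h3⟩, h4⟩; exact ⟨h1, by by_contra h5; exact h4 ⟨h1, by omega⟩, h3⟩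
    · intro y hy
      simp only [Finset.mem_filter] at hy ⊢
      exact ⟨hy.1, by omega⟩
  · rw [Nat.sub_eq_zero_of_le (rankIn_le_rankLt S h), Finset.card_eq_zero, pointsIn]
    exact Finset.filter_false_of_mem fun y _ => by omega

theorem rankLt_lt_rankIn {S : Finset ℕ} {a p : ℕ} (hp : p ∈ S) (h : a ≤ p) :
    rankLt S a < rankIn S p := by
  refine Finset.card_lt_card ⟨fun y hy => ?_, fun hsub => ?_⟩
  · simp only [Finset.mem_filter] at hy ⊢
    exact ⟨hy.1, by omega⟩
  · have := hsub (Finset.mem_filter.2 ⟨hp, le_rfl⟩)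
    rw [Finset.mem_filter] at this
    omega

theorem rankIn_injOn (S : Finset ℕ) : Set.InjOn (rankIn S) S := by
  intro x hx y hy hxy
  rcases lt_trichotomy x y with h | h | h
  · have h1 := rankLt_lt_rankIn hy le_rfl
    have h2 := rankIn_le_rankLt S h
    omega
  · exact h
  · have h1 := rankLt_lt_rankIn hx le_rfl
    have h2 := rankIn_le_rankLt S h
    omega

/-! Windows of points and the colors that are frequent in them. -/

/-- The points whose ranks are in the three blocks of length `2 ^ k` from the `q`-th one on. -/
def window (P : Finset ℕ) (k q : ℕ) : Finset ℕ :=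
  P.filter fun p => q * 2 ^ k < rankIn P p ∧ rankIn P p ≤ (q + 3) * 2 ^ k

theorem card_window_le (P : Finset ℕ) (k q : ℕ) : (window P k q).card ≤ 3 * 2 ^ k := by
  have h : (window P k q).card ≤ (Finset.Ioc (q * 2 ^ k) ((q + 3) * 2 ^ k)).card := by
    refine Finset.card_le_card_of_injOn (rankIn P) (fun p hp => ?_) fun x hx y hy h => ?_
    · simp only [window, Finset.mem_coe, Finset.mem_filter] at hp
      simpa using hp.2
    · exact rankIn_injOn P (Finset.mem_of_mem_filter _ hx) (Finset.mem_of_mem_filter _ hy) h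
  rw [Nat.card_Ioc, ← Nat.sub_mul] at h
  simpa using h

/-- The ranks in the interval start in block `q` and there are fewer than two block lengths of them,
so they end in block `q + 2` at the latest. -/
theorem pointsIn_subset_window {P : Finset ℕ} {a b : ℕ}
    (hlt : rankLt P a < rankIn P b) :
    pointsIn P a b ⊆ window P (Nat.log 2 (rankIn P b - rankLt P a))
      (rankLt P a / 2 ^ Nat.log 2 (rankIn P b - rankLt P a)) := by
  intro p hp
  simp only [pointsIn, window, Finset.mem_filter] at hp ⊢
  obtain ⟨hpP, ha, hb⟩ := hp
  have h1 := rankLt_lt_rankIn hpP ha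
  have h2 := rankIn_mono P hb
  have h3 := Nat.lt_pow_succ_log_self (b := 2) (by norm_num) (rankIn P b - rankLt P a)
  rw [Nat.succ_eq_add_one, pow_succ] at h3
  generalize 2 ^ Nat.log 2 (rankIn P b - rankLt P a) = B at *
  have hB : 0 < B := by omega
  have h4 := Nat.div_add_mod (rankLt P a) B
  have h5 := Nat.mod_lt (rankLt P a) hB
  rw [Nat.mul_comm] at h4
  refine ⟨hpP, by omega, ?_⟩
  rw [Nat.add_mul]
  omega

/-- The points with the `c`-th color. -/
noncomputable def colorClass (P : Finset ℕ) (col : ℕ → ℕ) (c : ℕ) : Finset ℕ :=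
  P.filter fun p => col p = nthElem (P.image col) c

open scoped Classical in
/-- The numbers of the colors that can `τ`-dominate an interval of the `k`-th level whose first
point is in the `q`-th block. -/
noncomputable def candidates (τ : ℝ) (P : Finset ℕ) (col : ℕ → ℕ) (k q : ℕ) : Finset ℕ :=
  (Finset.range (P.image col).card).filter fun c =>
    (2 : ℝ) ^ k ≤ τ * ((window P k q).filter fun p => col p = nthElem (P.image col) c).card

theorem sum_card_filter_color_le (P W : Finset ℕ) (col : ℕ → ℕ) {I : Finset ℕ}
    (hI : I ⊆ Finset.range (P.image col).card) :
    ∑ c ∈ I, (W.filter fun p => col p = nthElem (P.image col) c).card ≤ W.card := by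
  rw [← Finset.card_biUnion]
  · refine Finset.card_le_card fun p hp => ?_
    rw [Finset.mem_biUnion] at hp
    obtain ⟨c, _, hc⟩ := hp
    exact Finset.mem_of_mem_filter _ hc
  · intro c hc d hd hcd
    rw [Function.onFun, Finset.disjoint_left]
    intro p hp hp'
    rw [Finset.mem_filter] at hp hp'
    exact hcd (nthElem_injOn (Finset.mem_range.1 (hI hc)) (Finset.mem_range.1 (hI hd))
      (hp.2.symm.trans hp'.2))

/-- Each candidate has at least `2 ^ k / τ` points of the window, different colors have disjoint
sets of points, and the window has at most `3 * 2 ^ k` points. -/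
theorem card_candidates_le {τ : ℝ} (hτ : 0 ≤ τ) (P : Finset ℕ) (col : ℕ → ℕ) (k q : ℕ) :
    (candidates τ P col k q).card ≤ ⌊3 * τ⌋₊ := by
  apply Nat.le_floor
  have hI : candidates τ P col k q ⊆ Finset.range (P.image col).card := Finset.filter_subset _ _
  have h1 : ((candidates τ P col k q).card : ℝ) * 2 ^ k ≤ ∑ c ∈ candidates τ P col k q,
      τ * ((window P k q).filter fun p => col p = nthElem (P.image col) c).card := by
    rw [← nsmul_eq_mul]
    exact Finset.card_nsmul_le_sum _ _ _ fun c hc => (Finset.mem_filter.1 hc).2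
  rw [← Finset.mul_sum, ← Nat.cast_sum] at h1
  have h2 : ((∑ c ∈ candidates τ P col k q,
      ((window P k q).filter fun p => col p = nthElem (P.image col) c).card : ℕ) : ℝ) ≤
        3 * 2 ^ k := by
    exact_mod_cast (sum_card_filter_color_le P (window P k q) col hI).trans (card_window_le P k q)
  have h3 : ((candidates τ P col k q).card : ℝ) * 2 ^ k ≤ 3 * τ * 2 ^ k := by
    refine h1.trans ((mul_le_mul_of_nonneg_left h2 hτ).trans_eq (by ring))
  exact le_of_mul_le_mul_right h3 (by positivity)

theorem filter_pointsIn (P : Finset ℕ) (col : ℕ → ℕ) (a b v : ℕ) :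
    (pointsIn P a b).filter (fun p => col p = v) = pointsIn (P.filter fun p => col p = v) a b := by
  rw [pointsIn, pointsIn, Finset.filter_comm]

/-- The candidates in the window of an interval include all dominating colors. -/
theorem tauDominates_iff {τ : ℝ} (hτ : 1 ≤ τ) {P : Finset ℕ} {col : ℕ → ℕ} {a b : ℕ}
    (hlt : rankLt P a < rankIn P b) (v : ℕ) :
    TauDominates τ P col a b v ↔ ∃ c ∈ candidates τ P col
        (Nat.log 2 (rankIn P b - rankLt P a))
        (rankLt P a / 2 ^ Nat.log 2 (rankIn P b - rankLt P a)),
      ⌈((rankIn P b - rankLt P a : ℕ) : ℝ) / τ⌉₊ ≤ (pointsIn (colorClass P col c) a b).card ∧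
        v = nthElem (P.image col) c := by
  have hτ0 : 0 < τ := by linarith
  have hcard := card_pointsIn P a b
  have hsub := pointsIn_subset_window hlt
  have hne : (pointsIn P a b).Nonempty := Finset.card_pos.1 (by omega)
  unfold TauDominates
  rw [filter_pointsIn, hcard]
  constructor
  · rintro ⟨-, hdom⟩
    -- A dominating color occurs in the nonempty interval, hence in `P`, so it has a number.
    have hpos : 0 < (pointsIn (P.filter fun p => col p = v) a b).card := by
      rw [Nat.pos_iff_ne_zero]
      intro h0
      rw [h0, Nat.cast_zero, mul_zero, Nat.cast_nonpos] at hdom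
      omega
    obtain ⟨p, hp⟩ := Finset.card_pos.1 hpos
    simp only [pointsIn, Finset.mem_filter] at hp
    obtain ⟨c, hc, hcv⟩ := exists_nthElem_eq (Finset.mem_image.2 ⟨p, hp.1⟩ : v ∈ P.image col)
    subst hcv
    refine ⟨c, ?_, ?_, rfl⟩
    · rw [candidates, Finset.mem_filter, Finset.mem_range]
      refine ⟨hc, ?_⟩
      have h1 : 2 ^ Nat.log 2 (rankIn P b - rankLt P a) ≤ rankIn P b - rankLt P a :=
        Nat.pow_log_le_self 2 (by omega)
      have h2 : ((2 ^ Nat.log 2 (rankIn P b - rankLt P a) : ℕ) : ℝ) ≤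
          ((rankIn P b - rankLt P a : ℕ) : ℝ) := Nat.cast_le.2 h1
      rw [Nat.cast_pow, Nat.cast_ofNat] at h2
      refine h2.trans (hdom.trans (mul_le_mul_of_nonneg_left (Nat.cast_le.2 ?_) hτ0.le))
      rw [← filter_pointsIn]
      exact Finset.card_le_card (Finset.filter_subset_filter _ hsub)
    · rw [Nat.ceil_le, div_le_iff₀' hτ0]
      exact hdom
  · rintro ⟨c, _, hle, rfl⟩
    refine ⟨hne, ?_⟩
    rw [Nat.ceil_le, div_le_iff₀' hτ0] at hle
    exact hle

/-! ### The domination structure and its size. -/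

/-- The data structure for domination queries. -/
def DominationAt (w L : ℕ) (τ : ℝ) (P : Finset ℕ) (col : ℕ → ℕ) (mem : ℕ → Option ℕ) (p : ℕ) :
    Prop :=
  ∃ H TT LT RT CT, mem p = some H ∧ mem (p + 1) = some TT ∧ mem (p + 2) = some LT ∧
    mem (p + 3) = some RT ∧ mem (p + 4) = some CT ∧ RankAt w L P mem H ∧
    (∀ m < P.card + 1, mem (TT + m) = some ⌈(m : ℝ) / τ⌉₊) ∧
    (∀ m < P.card + 1, mem (LT + m) = some (Nat.log 2 m)) ∧
    (∀ k < Nat.log 2 P.card + 1, ∃ row, mem (RT + k) = some row ∧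
      ∀ q < P.card / 2 ^ k + 1, ∃ l, mem (row + q) = some l ∧
        mem l = some (candidates τ P col k q).card ∧
        ∀ t < (candidates τ P col k q).card,
          mem (l + 1 + t) = some (nthElem (candidates τ P col k q) t)) ∧
    ∀ c < (P.image col).card, ∃ r, mem (CT + c) = some r ∧
      mem r = some (nthElem (P.image col) c) ∧ RankAt w L (colorClass P col c) mem (r + 1)

theorem mem_candidates_lt {τ : ℝ} {P : Finset ℕ} {col : ℕ → ℕ} {k q c : ℕ}
    (h : c ∈ candidates τ P col k q) : c < (P.image col).card :=
  Finset.mem_range.1 (Finset.mem_of_mem_filter _ h)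

theorem placeable_domination {w L : ℕ} (hL : 1 ≤ L) (hLw : L ≤ w) {τ : ℝ} (hτ : 1 ≤ τ)
    {P : Finset ℕ} (hne : P.Nonempty) (hP : ∀ p ∈ P, p < 2 ^ L) {col : ℕ → ℕ}
    (hcol : ∀ p, col p < 2 ^ w) :
    Placeable w ((4 * ⌊3 * τ⌋₊ + 450) * P.card) (DominationAt w L τ P col) := by
  apply Placeable.of_lt
  intro hlt
  have hτ0 : 0 < τ := by linarith
  have hn : 1 ≤ P.card := Finset.card_pos.2 hne
  have hexp : (4 * ⌊3 * τ⌋₊ + 450) * P.card = 4 * (⌊3 * τ⌋₊ * P.card) + 450 * P.card := by ring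
  have hκ : ⌊3 * τ⌋₊ ≤ ⌊3 * τ⌋₊ * P.card := Nat.le_mul_of_pos_right _ hn
  have hQ : (P.image col).card ≤ P.card := Finset.card_image_le
  have hrank := placeable_rank hL hLw hne hP
  have hthr : ∀ m < P.card + 1, ⌈(m : ℝ) / τ⌉₊ < 2 ^ w := by
    intro m hm
    have : ⌈(m : ℝ) / τ⌉₊ ≤ m := Nat.ceil_le.2 (div_le_self (Nat.cast_nonneg m) hτ)
    omega
  have hlog : ∀ m < P.card + 1, Nat.log 2 m < 2 ^ w := fun m hm => by
    have := Nat.log_le_self 2 m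
    omega
  have hlist : ∀ k q, Placeable w (⌊3 * τ⌋₊ + 1) fun mem l =>
      mem l = some (candidates τ P col k q).card ∧ ∀ t < (candidates τ P col k q).card,
        mem (l + 1 + t) = some (nthElem (candidates τ P col k q) t) := by
    intro k q
    have h1 := card_candidates_le hτ0.le P col k q
    refine (Placeable.consVal (by omega) (Placeable.table fun t ht => ?_)).mono (by omega)
      fun mem l h => h
    have := mem_candidates_lt (nthElem_mem ht)
    omega
  have hclass : ∀ c < (P.image col).card,
      Placeable w (200 * (colorClass P col c).card + 1) fun mem r =>
        mem r = some (nthElem (P.image col) c) ∧ RankAt w L (colorClass P col c) mem (r + 1) := by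
    intro c hc
    obtain ⟨p, hp, hpc⟩ := Finset.mem_image.1 (nthElem_mem hc)
    refine Placeable.consVal ?_ (placeable_rank hL hLw ⟨p, Finset.mem_filter.2 ⟨hp, hpc⟩⟩
      fun x hx => hP x (Finset.mem_of_mem_filter x hx))
    rw [← hpc]
    exact hcol p
  have hrows := Placeable.ptrs (T := Nat.log 2 P.card + 1) fun k _ =>
    Placeable.ptrs (T := P.card / 2 ^ k + 1) fun q _ => hlist k q
  refine (Placeable.consPtr hrank (Placeable.consPtr (Placeable.table hthr)
    (Placeable.consPtr (Placeable.table hlog) (Placeable.consPtr hrows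
      (Placeable.consPtr (Placeable.ptrs hclass) Placeable.trivial))))).mono ?_ ?_
  · have hclasses : ∑ c ∈ Finset.range (P.image col).card,
        (200 * (colorClass P col c).card + 1 + 1) ≤ 202 * P.card := by
      rw [Finset.sum_add_distrib, Finset.sum_add_distrib, ← Finset.mul_sum]
      have := sum_card_filter_color_le P P col (subset_refl _)
      simp only [Finset.sum_const, Finset.card_range, smul_eq_mul]
      simp only [colorClass]
      omega
    -- On levels up to `log₂ n` the quotient `n / 2 ^ k` is at least `1` and absorbs the additive
    -- constants; the quotients sum to at most `2 * n`.
    have hwindows : ∑ k ∈ Finset.range (Nat.log 2 P.card + 1),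
        (∑ q ∈ Finset.range (P.card / 2 ^ k + 1), (⌊3 * τ⌋₊ + 1 + 1) + 1) ≤
          4 * (⌊3 * τ⌋₊ * P.card) + 10 * P.card := by
      have hgeom := Nat.geom_sum_le (b := 2) le_rfl P.card (Nat.log 2 P.card + 1)
      calc _ ≤ ∑ k ∈ Finset.range (Nat.log 2 P.card + 1),
            (P.card / 2 ^ k) * (2 * ⌊3 * τ⌋₊ + 5) := by
            refine Finset.sum_le_sum fun k hk => ?_
            rw [Finset.mem_range] at hk
            have h1 : 1 ≤ P.card / 2 ^ k := by
              rw [Nat.one_le_div_iff (by positivity)]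
              exact (Nat.pow_le_pow_right (by norm_num) (by omega)).trans
                (Nat.pow_log_le_self 2 (by omega))
            rw [Finset.sum_const, Finset.card_range, smul_eq_mul]
            nlinarith
        _ = (∑ k ∈ Finset.range (Nat.log 2 P.card + 1), P.card / 2 ^ k) *
            (2 * ⌊3 * τ⌋₊ + 5) := (Finset.sum_mul _ _ _).symm
        _ ≤ (P.card * 2) * (2 * ⌊3 * τ⌋₊ + 5) :=
            Nat.mul_le_mul_right _ (by simpa using hgeom)
        _ = _ := by ring
    omega
  · rintro mem p ⟨⟨H, h0, hH⟩, ⟨TT, h1, hTT⟩, ⟨LT, h2, hLT⟩, ⟨RT, h3, hRT⟩, ⟨CT, h4, hCT⟩, -⟩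
    exact ⟨H, TT, LT, RT, CT, h0, h1, h2, h3, h4, hH, hTT, hLT, hRT, hCT⟩

/-! ### The query algorithm and its correctness. -/

namespace WordRAM.Stmt

open Exp

/-- For the rank structure in variable `10` put the number of elements below variable `0` into
variable `8`, and the number of elements that are at most variable `1` into variable `9`. -/
def ranks : Stmt :=
  .seq (.assign 11 (var 1)) <|
  .seq rankLe <|
  .seq (.assign 9 (var 12)) <|
  .seq (.ifLt (lit 0) (var 0) (.seq (.assign 11 (bin .sub (var 0) (lit 1))) rankLe)
    (.assign 12 (lit 0))) <|
  .assign 8 (var 12)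

theorem wp_ranks {w L : ℕ} (hw : 4 ≤ w) (hL : 1 ≤ L) (hLw : L ≤ w) {mem : ℕ → Option ℕ}
    (hm : MemWords w mem) {S : Finset ℕ} (hn : S.card + w < 2 ^ w ∧ 2 * S.card + 1 < 2 ^ w)
    {σ : Store} (hp : RankAt w L S mem (σ.val 10)) (ha : σ.val 0 < 2 ^ w) :
    WP w mem ranks (Nat.clog 2 L + 2) (fun σ' => σ'.val 8 = rankLt S (σ.val 0) ∧
      σ'.val 9 = rankIn S (σ.val 1) ∧ Store.Agree 8 σ σ') σ := by
  have hK : 0 < Nat.clog 2 L + 2 := by omega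
  refine .seq (.assign hK (eval_var rfl) ?_)
  refine .seq ((wp_rankLe (S := S) hw hL hLw hm hn (by simpa [Store.set_val] using hp)).mono le_rfl
    ?_)
  rintro τ ⟨h12, hag⟩
  simp only [Store.set_val, if_pos] at h12
  have hag₁₁ : Store.Agree 11 σ τ := ((Store.Agree.refl 11 σ).set le_rfl _).trans
    (hag.mono (by norm_num))
  refine .seq (.assign hK (eval_var h12) ?_)
  have hτ0 : (τ.set 9 (rankIn S (σ.val 1))).val 0 = σ.val 0 := by
    simp [Store.set_val, hag₁₁.1 0 (by norm_num)]
  have hτ10 : (τ.set 9 (rankIn S (σ.val 1))).val 10 = σ.val 10 := by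
    simp [Store.set_val, hag₁₁.1 10 (by norm_num)]
  have hag₈ : Store.Agree 8 σ (τ.set 9 (rankIn S (σ.val 1))) :=
    (hag₁₁.mono (by norm_num)).set (by norm_num) _
  have h9 : (τ.set 9 (rankIn S (σ.val 1))).val 9 = rankIn S (σ.val 1) := by
    simp [Store.set_val]
  generalize τ.set 9 (rankIn S (σ.val 1)) = τ₁ at *
  -- The number of elements below `a` is the rank of `a - 1`; for `a = 0` the subtraction would wrap
  -- around, and the count is `0`.
  refine .seq (.ifLt hK (eval_lit (by omega)) (eval_var hτ0) (fun hpos => ?_) fun hpos => ?_)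
  · refine .seq (.assign hK (eval_sub (eval_var hτ0) (eval_lit (by omega)) hpos ha) ?_)
    refine (wp_rankLe (S := S) hw hL hLw hm hn
      (by simpa [Store.set_val, hτ10] using hp)).mono le_rfl ?_
    rintro τ₂ ⟨h12, hag₂⟩
    simp only [Store.set_val, if_pos, rankIn_sub_one S hpos] at h12
    refine .assign hK (eval_var h12) ⟨by simp [Store.set_val], ?_, ?_⟩
    · simp [Store.set_val, hag₂.1 9 (by norm_num), h9]
    · exact ((hag₈.set (by norm_num) _).trans (hag₂.mono (by norm_num))).set le_rfl _
  · refine .assign hK (eval_lit (by omega)) (.assign hK (eval_var (x := 0)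
      (by simp [Store.set_val])) ⟨?_, ?_, ?_⟩)
    · rw [show σ.val 0 = 0 by omega, rankLt_zero]
      simp [Store.set_val]
    · simp [Store.set_val, h9]
    · exact (hag₈.set (by norm_num) _).set le_rfl _

/-- Report the dominating colors in the list of candidates whose address is in variable `5` and
whose length is in variable `6`; the threshold is in variable `3`. -/
def reportLoop : Stmt :=
  .whileLt (lit 0) (var 6) <|
    .seq (.assign 7 (cell (field (lit 0) 4) (cell (var 5) (var 6)))) <|
    .seq (.assign 10 (bin .add (var 7) (lit 1))) <|
    .seq ranks <|
    .seq (.ifLt (bin .sub (var 9) (var 8)) (var 3) (.assign 7 (var 7)) (.output (get (var 7)))) <|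
    .assign 6 (bin .sub (var 6) (lit 1))

/-- The list is processed from its end. When variable `6` is `r`, the candidates from `r` on have
been decided; since cell `0` of the list holds its length, candidate `r` is in cell `r + 1`.
Different candidates have different colors (`hinj`), so nothing is reported twice. -/
theorem wp_reportLoop {w L : ℕ} (hw : 4 ≤ w) (hL : 1 ≤ L) (hLw : L ≤ w) {mem : ℕ → Option ℕ}
    (hm : MemWords w mem) {n CT N : ℕ} (hn : n + w < 2 ^ w ∧ 2 * n + 1 < 2 ^ w)
    (hCT : mem 4 = some CT) {color : ℕ → ℕ} {part : ℕ → Finset ℕ}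
    (hC : ∀ c < N, ∃ r, mem (CT + c) = some r ∧
      mem r = some (color c) ∧ RankAt w L (part c) mem (r + 1))
    (hpart : ∀ c < N, (part c).card ≤ n) {cand : ℕ → ℕ} {len : ℕ}
    {σ : Store} (hcand : ∀ t < len, mem (σ.val 5 + 1 + t) = some (cand t) ∧ cand t < N)
    (hinj : ∀ s < len, ∀ t < len, color (cand s) = color (cand t) → s = t)
    (h6 : σ.val 6 = len) (hlen : len < 2 ^ w) (ha : σ.val 0 < 2 ^ w) (hab : σ.val 0 ≤ σ.val 1)
    (hout : σ.out = []) :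
    WP w mem reportLoop ((Nat.clog 2 L + 2) * (len + 1)) (fun σ' => σ'.out.Nodup ∧
      ∀ v, v ∈ σ'.out ↔ ∃ t < len,
        σ.val 3 ≤ (pointsIn (part (cand t)) (σ.val 0) (σ.val 1)).card ∧ v = color (cand t)) σ := by
  have hK : 0 < Nat.clog 2 L + 2 := by omega
  have hlit : ∀ {τ : Store} {k}, k ≤ 4 → (lit k).eval w mem τ.val = some k :=
    fun hk => eval_lit (by omega)
  refine .whileLt hK (fun r τ => τ.val 6 = r ∧ r ≤ len ∧ (∀ i < 6, τ.val i = σ.val i) ∧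
    τ.out.Nodup ∧ ∀ v, v ∈ τ.out ↔ ∃ t < len, r ≤ t ∧
      σ.val 3 ≤ (pointsIn (part (cand t)) (σ.val 0) (σ.val 1)).card ∧ v = color (cand t)) ?_ _ ?_
  swap
  · refine ⟨h6, le_rfl, fun _ _ => rfl, by simp [hout], fun v => ?_⟩
    rw [hout]
    simp only [List.not_mem_nil, false_iff, not_exists, not_and]
    omega
  rintro r τ ⟨h6, hr, hval, hnd, hmem⟩
  refine ⟨0, r, hlit (by norm_num), eval_var h6, fun hpos => ?_, fun hzero => ⟨hnd, fun v => ?_⟩⟩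
  swap
  · rw [hmem]
    refine exists_congr fun t => and_congr_right fun _ => ?_
    simp only [show r ≤ t by omega, true_and]
  obtain ⟨r, rfl⟩ : ∃ s, r = s + 1 := ⟨r - 1, by omega⟩
  refine ⟨r, rfl, ?_⟩
  obtain ⟨hct, hctN⟩ := hcand r (by omega)
  obtain ⟨rec, hrec, hcolor, hrank⟩ := hC _ hctN
  obtain ⟨_, _, _, hfield, -⟩ := id hrank
  have hrec1 := (hm _ _ hfield).1
  rw [show σ.val 5 + 1 + r = σ.val 5 + (r + 1) by omega] at hct
  refine .seq (.assign hK (eval_cell hm (eval_field hm (hlit (by norm_num)) (by simpa using hCT))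
    (eval_cell hm (eval_var (hval 5 (by norm_num))) (eval_var h6) hct) hrec) ?_)
  refine .seq (.assign hK (v := rec + 1) (eval_add (eval_var (by simp [Store.set_val]))
    (hlit (by norm_num)) hrec1) ?_)
  generalize hτ₁ : (τ.set 7 rec).set 10 (rec + 1) = τ₁
  have hv : ∀ i < 7, τ₁.val i = τ.val i := fun i hi => by
    rw [← hτ₁, Store.set_val, Store.set_val, if_neg (by omega), if_neg (by omega)]
  have hv7 : τ₁.val 7 = rec := by simp [← hτ₁, Store.set_val]
  have hv10 : τ₁.val 10 = rec + 1 := by simp [← hτ₁, Store.set_val]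
  have ho : τ₁.out = τ.out := by rw [← hτ₁]; rfl
  have h0 : τ₁.val 0 = σ.val 0 := (hv 0 (by norm_num)).trans (hval 0 (by norm_num))
  have h1 : τ₁.val 1 = σ.val 1 := (hv 1 (by norm_num)).trans (hval 1 (by norm_num))
  have hc := hpart _ hctN
  refine .seq ((wp_ranks (S := part (cand r)) hw hL hLw hm (by omega) (by rwa [hv10])
    (by rwa [h0])).mono le_rfl ?_)
  rintro τ₂ ⟨h8, h9, hag⟩
  rw [h0] at h8
  rw [h1] at h9
  have hcnt := card_pointsIn (part (cand r)) (σ.val 0) (σ.val 1)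
  have hle := rankLt_le_rankIn (part (cand r)) hab
  have hrc := rankIn_le_card (part (cand r)) (σ.val 1)
  have hstep : ∀ o : List ℕ, o.Nodup → (∀ v, v ∈ o ↔ ∃ t < len, r ≤ t ∧
      σ.val 3 ≤ (pointsIn (part (cand t)) (σ.val 0) (σ.val 1)).card ∧ v = color (cand t)) →
      ∀ τ₃ : Store, (∀ i < 7, τ₃.val i = τ₂.val i) → τ₃.out = o →
      WP w mem (.assign 6 (bin .sub (var 6) (lit 1))) (Nat.clog 2 L + 2) (fun τ => τ.val 6 = r ∧
        r ≤ len ∧ (∀ i < 6, τ.val i = σ.val i) ∧ τ.out.Nodup ∧ ∀ v, v ∈ τ.out ↔ ∃ t < len, r ≤ t ∧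
          σ.val 3 ≤ (pointsIn (part (cand t)) (σ.val 0) (σ.val 1)).card ∧
          v = color (cand t)) τ₃ := by
    rintro o ho1 ho2 τ₃ h7 rfl
    have hx : τ₃.val 6 = r + 1 := by
      rw [h7 6 (by norm_num), hag.1 6 (by norm_num), hv 6 (by norm_num), h6]
    refine .assign hK (eval_sub (eval_var hx) (hlit (by norm_num)) (by omega) (by omega))
      ⟨by simp [Store.set_val], by omega, fun i hi => ?_, ho1, ho2⟩
    rw [Store.set_val, if_neg (by omega), h7 i (by omega), hag.1 i (by omega), hv i (by omega),
      hval i hi]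
  have h3 : τ₂.val 3 = σ.val 3 := by
    rw [hag.1 3 (by norm_num), hv 3 (by norm_num), hval 3 (by norm_num)]
  have h7 : τ₂.val 7 = rec := by rw [hag.1 7 (by norm_num), hv7]
  have hout₂ : τ₂.out = τ.out := hag.2.trans ho
  refine .seq (.ifLt hK (eval_sub (eval_var h9) (eval_var h8) hle (by omega)) (eval_var h3)
    (fun hl => ?_) fun hl => ?_)
  · refine .assign hK (eval_var h7) (hstep τ.out hnd (fun v => ?_) _ (fun i hi => ?_) hout₂)
    · rw [hmem]
      refine exists_congr fun t => and_congr_right fun _ => ?_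
      constructor
      · rintro ⟨h4, h5⟩
        exact ⟨by omega, h5⟩
      · rintro ⟨h4, h5⟩
        refine ⟨?_, h5⟩
        rcases h4.eq_or_lt with rfl | h4
        · omega
        · exact h4
    · rw [Store.set_val, if_neg (by omega)]
  · refine .output hK (eval_get (eval_var h7) hcolor) (hstep (τ.out ++ [color (cand r)]) ?_
      (fun v => ?_) _ (fun i hi => rfl) (by rw [hout₂]))
    · rw [← List.concat_eq_append, List.nodup_concat]
      refine ⟨fun hin => ?_, hnd⟩
      obtain ⟨t, ht, hrt, -, heq⟩ := (hmem _).1 hin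
      have := hinj _ (by omega) _ ht heq
      omega
    · rw [List.mem_append, hmem, List.mem_singleton]
      constructor
      · rintro (⟨t, ht, hrt, h⟩ | rfl)
        · exact ⟨t, ht, by omega, h⟩
        · exact ⟨r, by omega, le_rfl, by omega, rfl⟩
      · rintro ⟨t, ht, hrt, h4, h5⟩
        rcases hrt.eq_or_lt with rfl | hrt
        · exact Or.inr h5
        · exact Or.inl ⟨t, ht, hrt, h4, h5⟩

/-- The query algorithm. -/
def domination : Stmt :=
  .seq (.assign 10 (field (lit 0) 0)) <|
  .seq ranks <|
  .ifLt (var 8) (var 9)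
    (.seq (.assign 2 (bin .sub (var 9) (var 8))) <|
     .seq (.assign 3 (cell (field (lit 0) 1) (var 2))) <|
     .seq (.assign 4 (cell (field (lit 0) 2) (var 2))) <|
     .seq (.assign 5 (cell (cell (field (lit 0) 3) (var 4)) (bin .shr (var 8) (var 4)))) <|
     .seq (.assign 6 (get (var 5))) <|
     reportLoop)
    (.assign 2 (var 2))

/-- At most `⌊3 * τ⌋₊` candidates are checked, each by one call of `ranks`. Equal ranks mean an
empty interval, including the case `b < a`, and nothing is reported. -/
theorem wp_domination {w L : ℕ} (hw : 4 ≤ w) (hL : 1 ≤ L) (hLw : L ≤ w) {τ : ℝ} (hτ : 1 ≤ τ)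
    {P : Finset ℕ} {col : ℕ → ℕ} {mem : ℕ → Option ℕ} (hm : MemWords w mem)
    (hn : P.card + w < 2 ^ w ∧ 2 * P.card + 1 < 2 ^ w) (hD : DominationAt w L τ P col mem 0)
    {σ : Store} (ha : σ.val 0 < 2 ^ w) (hout : σ.out = []) :
    WP w mem domination ((Nat.clog 2 L + 2) * (⌊3 * τ⌋₊ + 1)) (fun σ' => σ'.out.Nodup ∧
      ∀ v, v ∈ σ'.out ↔ TauDominates τ P col (σ.val 0) (σ.val 1) v) σ := by
  obtain ⟨H, TT, LT, RT, CT, h0, h1, h2, h3, h4, hH, hTT, hLT, hRT, hCT⟩ := hD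
  have hK : 0 < (Nat.clog 2 L + 2) * (⌊3 * τ⌋₊ + 1) := by positivity
  have hle : Nat.clog 2 L + 2 ≤ (Nat.clog 2 L + 2) * (⌊3 * τ⌋₊ + 1) :=
    Nat.le_mul_of_pos_right _ (by omega)
  have hlit : ∀ {τ : Store} {k}, k ≤ 4 → (lit k).eval w mem τ.val = some k :=
    fun hk => eval_lit (by omega)
  have hfield : ∀ {τ : Store} {k v}, mem (0 + k) = some v →
      (field (lit 0) k).eval w mem τ.val = some v :=
    fun hv => eval_field hm (hlit (by norm_num)) hv
  refine .seq (.assign hK (hfield h0) ?_)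
  refine .seq ((wp_ranks (S := P) hw hL hLw hm hn (by simpa [Store.set_val] using hH)
    (by simpa [Store.set_val] using ha)).mono hle ?_)
  rintro τ₁ ⟨h8, h9, hag⟩
  simp only [Store.set_val, show (0 : ℕ) ≠ 10 by norm_num, show (1 : ℕ) ≠ 10 by norm_num,
    if_false] at h8 h9
  have hag : Store.Agree 2 σ τ₁ :=
    ((Store.Agree.refl 2 σ).set (by norm_num) _).trans (hag.mono (by norm_num))
  have hcard := card_pointsIn P (σ.val 0) (σ.val 1)
  refine .ifLt hK (eval_var h8) (eval_var h9) (fun hlt => ?_) fun hge => ?_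
  swap
  · refine .assign hK (eval_var rfl) ?_
    rw [Store.set_out, hag.2, hout]
    refine ⟨List.nodup_nil, fun v => ?_⟩
    simp only [List.not_mem_nil, false_iff, TauDominates, not_and]
    intro hne
    have := Finset.card_pos.2 hne
    omega
  have hab : σ.val 0 ≤ σ.val 1 := by
    by_contra hcon
    have := rankIn_le_rankLt P (show σ.val 1 < σ.val 0 by omega)
    omega
  have hrc := rankIn_le_card P (σ.val 1)
  have hm2 := hTT (rankIn P (σ.val 1) - rankLt P (σ.val 0)) (by omega)
  have hm3 := hLT (rankIn P (σ.val 1) - rankLt P (σ.val 0)) (by omega)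
  have hdom := fun v => tauDominates_iff (col := col) hτ hlt v
  have hkn : Nat.log 2 (rankIn P (σ.val 1) - rankLt P (σ.val 0)) ≤ Nat.log 2 P.card :=
    Nat.log_mono_right (by omega)
  generalize Nat.log 2 (rankIn P (σ.val 1) - rankLt P (σ.val 0)) = k at *
  obtain ⟨row, hrow, hrow'⟩ := hRT k (by omega)
  have hq : rankLt P (σ.val 0) / 2 ^ k ≤ P.card / 2 ^ k := Nat.div_le_div_right (by omega)
  obtain ⟨l, hl, hlen, hcand⟩ := hrow' (rankLt P (σ.val 0) / 2 ^ k) (by omega)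
  generalize hqe : rankLt P (σ.val 0) / 2 ^ k = q at *
  refine .seq (.assign hK (eval_sub (eval_var h9) (eval_var h8) hlt.le (by omega)) ?_)
  refine .seq (.assign hK (eval_cell hm (hfield h1) (eval_var (by simp [Store.set_val])) hm2) ?_)
  refine .seq (.assign hK (eval_cell hm (hfield h2) (eval_var (by simp [Store.set_val])) hm3) ?_)
  refine .seq (.assign hK (eval_cell hm (eval_cell hm (hfield h3)
    (eval_var (by simp [Store.set_val])) hrow) ((eval_shr (eval_var (by simp [Store.set_val, h8]))
      (eval_var (by simp [Store.set_val]))).trans (congrArg some hqe)) hl) ?_)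
  refine .seq (.assign hK (eval_get (eval_var (by simp [Store.set_val])) hlen) ?_)
  have hκ : (candidates τ P col k q).card ≤ ⌊3 * τ⌋₊ :=
    card_candidates_le (by linarith) P col k q
  have hlt' := hm _ _ hlen
  have hcN : ∀ t < (candidates τ P col k q).card,
      nthElem (candidates τ P col k q) t < (P.image col).card := fun t ht =>
    mem_candidates_lt (nthElem_mem ht)
  have hv0 := hag.1 0 (by norm_num)
  have hv1 := hag.1 1 (by norm_num)
  refine (wp_reportLoop (n := P.card) (CT := CT) (N := (P.image col).card)
    (color := nthElem (P.image col)) (part := colorClass P col)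
    (cand := nthElem (candidates τ P col k q)) (len := (candidates τ P col k q).card)
    hw hL hLw hm hn (by simpa using h4) hCT (fun c _ => Finset.card_filter_le _ _) ?_ ?_ ?_
    hlt'.2 ?_ ?_ ?_).mono (Nat.mul_le_mul_left _ (by omega)) ?_
  · intro t ht
    refine ⟨?_, hcN t ht⟩
    simpa [Store.set_val] using hcand t ht
  · intro s hs t ht hst
    exact nthElem_injOn hs ht (nthElem_injOn (hcN s hs) (hcN t ht) hst)
  · simp [Store.set_val]
  · simpa [Store.set_val, hv0] using ha
  · simpa [Store.set_val, hv0, hv1] using hab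
  · simpa [Store.set_out, hag.2] using hout
  · rintro τ₂ ⟨hnd, hmem⟩
    refine ⟨hnd, fun v => ?_⟩
    rw [hmem, hdom]
    simp only [Store.set_val, hv0, hv1]
    norm_num
    constructor
    · rintro ⟨t, ht, h5, h6⟩
      exact ⟨_, nthElem_mem ht, h5, h6⟩
    · rintro ⟨c, hc, h5, h6⟩
      obtain ⟨t, ht, rfl⟩ := exists_nthElem_eq hc
      exact ⟨t, ht, h5, h6⟩

end WordRAM.Stmt

/-! ### Real bounds and the final assembly. -/

theorem one_le_loglog (x : ℕ) : 1 ≤ loglog x := le_max_left _ _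

/-- If `c` is the rounded-up logarithm of `log₂ U + 1`, then `2 ^ (c - 1)` is at most the
rounded-down `log₂ U`, unless the latter is `0`. -/
theorem clog_log_le (U : ℕ) : ((Nat.clog 2 (Nat.log 2 U + 1) : ℕ) : ℝ) ≤ 1 + loglog U := by
  have h1 := one_le_loglog U
  rcases Nat.eq_zero_or_pos (Nat.log 2 U) with h0 | hpos
  · rw [h0, Nat.zero_add, Nat.clog_one_right, Nat.cast_zero]
    linarith
  · have hU : U ≠ 0 := by
      rintro rfl
      simp at hpos
    have hlt := Nat.pow_pred_clog_lt_self (b := 2) (by norm_num)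
      (show 1 < Nat.log 2 U + 1 by omega)
    have hc := Nat.clog_pos (b := 2) (by norm_num) (show 2 ≤ Nat.log 2 U + 1 by omega)
    generalize Nat.clog 2 (Nat.log 2 U + 1) = c at *
    obtain ⟨d, rfl⟩ := Nat.exists_eq_succ_of_ne_zero hc.ne'
    rw [Nat.pred_succ] at hlt
    have h2 : ((2 ^ d : ℕ) : ℝ) ≤ (Nat.log 2 U : ℕ) := Nat.cast_le.2 (by omega)
    have h3 : ((Nat.log 2 U : ℕ) : ℝ) ≤ Real.logb 2 U := by
      simpa using Real.natLog_le_logb U 2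
    have h4 : (2 : ℝ) ^ (d : ℝ) ≤ Real.logb 2 U := by
      rw [Real.rpow_natCast]
      exact_mod_cast h2.trans h3
    have h5 : (d : ℝ) ≤ Real.logb 2 (Real.logb 2 U) := by
      rw [Real.le_logb_iff_rpow_le (by norm_num) (lt_of_lt_of_le (by positivity) h4)]
      exact h4
    have h6 : (d : ℝ) ≤ loglog U := h5.trans (le_max_right _ _)
    rw [Nat.succ_eq_add_one, Nat.cast_add, Nat.cast_one]
    linarith

theorem tauDominates_toNat {w : ℕ} (τ : ℝ) (P : Finset ℕ) (col : ℕ → BitVec w) (a b : ℕ)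
    (c : BitVec w) :
    TauDominates τ P (fun p => (col p).toNat) a b c.toNat ↔ TauDominates τ P col a b c := by
  simp only [TauDominates, BitVec.toNat_inj]

theorem WordRAM.Stmt.varsLt_domination : WordRAM.Stmt.domination.varsLt 30 = true := by
  decide

theorem theorem2 :
    ∃ (prog : List WordRAM.Instr) (C : ℕ),
      ∀ (w U : ℕ) (τ : ℝ) (P : Finset ℕ) (col : ℕ → BitVec w),
        1 ≤ τ → P.Nonempty → (∀ p ∈ P, p ≤ U) →
        U < 2 ^ w → (C : ℝ) * τ * (P.card : ℝ) ≤ 2 ^ w →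
        ∃ s : ℕ, (s : ℝ) ≤ C * τ * (P.card : ℝ) ∧
          SupportsDomination prog s (C * τ * loglog U * loglog P.card) τ P col := by
  have hwp := @WordRAM.Stmt.wp_domination
  have hvars := WordRAM.Stmt.varsLt_domination
  generalize WordRAM.Stmt.domination = prog at hwp hvars
  -- All variables are below `30`, so intermediate results start at register `30`. The `1000` covers
  -- the space, where `462` suffices, and `16 * prog.len` covers the time.
  refine ⟨prog.code 30 0 ++ [.halt], 1000 + 16 * prog.len, ?_⟩
  intro w U τ P col hτ hne hU hUw hC
  generalize hlen : prog.len = B at *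
  have hn : 1 ≤ P.card := Finset.card_pos.2 hne
  have hnR : (1 : ℝ) ≤ P.card := by exact_mod_cast hn
  have hκ : (⌊3 * τ⌋₊ : ℝ) ≤ 3 * τ := Nat.floor_le (by linarith)
  have hτn : 1 * (P.card : ℝ) ≤ τ * P.card := mul_le_mul_of_nonneg_right hτ (by linarith)
  have hB : (0 : ℝ) ≤ B * (τ * P.card) := by positivity
  push_cast at hC ⊢
  -- `4 * ⌊3 * τ⌋₊ + 450 ≤ 12 * τ + 450 ≤ 462 * τ`, by `1 ≤ τ`.
  have hsize : (((4 * ⌊3 * τ⌋₊ + 450) * P.card : ℕ) : ℝ) ≤ 462 * (τ * P.card) := by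
    push_cast
    nlinarith
  have hNw : (4 * ⌊3 * τ⌋₊ + 450) * P.card < 2 ^ w := by
    have : (((4 * ⌊3 * τ⌋₊ + 450) * P.card : ℕ) : ℝ) < ((2 ^ w : ℕ) : ℝ) := by
      push_cast at hsize ⊢
      nlinarith
    exact_mod_cast this
  have hnw : 450 * P.card < 2 ^ w := by nlinarith
  have hw : 4 ≤ w := by
    by_contra hcon
    have : 2 ^ w ≤ 2 ^ 4 := Nat.pow_le_pow_right (by norm_num) (by omega)
    omega
  have hw2 : 2 * w < 2 ^ w := by
    obtain ⟨v, rfl⟩ : ∃ v, w = v + 4 := ⟨w - 4, by omega⟩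
    have : v < 2 ^ v := Nat.lt_two_pow_self
    rw [pow_add]
    omega
  have hLw : Nat.log 2 U + 1 ≤ w := by
    rcases Nat.eq_zero_or_pos U with rfl | hpos
    · simp only [Nat.log_zero_right]
      omega
    · exact Nat.log_lt_of_lt_pow hpos.ne' hUw
  -- `L` is the number of bits of `U`; the structure is placed at address `0`.
  obtain ⟨l, hl, hlw, hD⟩ := placeable_domination (w := w) (L := Nat.log 2 U + 1) (by omega) hLw hτ
    hne (fun p hp => (hU p hp).trans_lt (Nat.lt_pow_succ_log_self (by norm_num) U))
    (col := fun p => (col p).toNat) (fun p => (col p).isLt) 0 (by omega)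
  have hD := hD _ (Stored.self l)
  have hmw : WordRAM.MemWords w fun i => l[i]? := by
    intro a v hv
    obtain ⟨ha, rfl⟩ := List.getElem?_eq_some_iff.1 hv
    exact ⟨by omega, hlw _ (List.getElem_mem ha)⟩
  -- The data structure fills the whole memory: queries keep everything in registers and need no
  -- work space.
  refine ⟨l.length, ?_, l.length, le_rfl, fun i => BitVec.ofNat w l[i], fun M hM a b => ?_⟩
  · have : (l.length : ℝ) ≤ (((4 * ⌊3 * τ⌋₊ + 450) * P.card : ℕ) : ℝ) := Nat.cast_le.2 hl
    nlinarith
  have hrep : WordRAM.Stmt.Represents 30 l.length (fun i => l[i]?)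
      ⟨fun r => ((WordRAM.start M a b).reg r).toNat, []⟩ (WordRAM.start M a b) := by
    refine ⟨fun _ _ => rfl, fun i v hv => ?_, rfl⟩
    obtain ⟨hi, rfl⟩ := List.getElem?_eq_some_iff.1 hv
    refine ⟨hi, ?_⟩
    have h1 : (WordRAM.start M a b).mem i = BitVec.ofNat w l[i] := hM ⟨i, hi⟩
    rw [h1, BitVec.toNat_ofNat, Nat.mod_eq_of_lt (hlw _ (List.getElem_mem hi))]
  obtain ⟨t, ht, ρ, hexec, hnd, hmem⟩ := hwp hw (by omega) hLw hτ hmw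
    (by omega) hD (σ := ⟨fun r => ((WordRAM.start M a b).reg r).toNat, []⟩)
    (BitVec.isLt _) rfl
  have hcode : Stored (fun i => (prog.code 30 0 ++ [.halt])[i]?) 0
      (prog.code 30 0 ++ [.halt]) := Stored.self _
  rw [Stored.append_iff, Stored.cons_iff, WordRAM.Stmt.length_code] at hcode
  obtain ⟨σ, hrun, hpc, hσ, hσm⟩ := WordRAM.Stmt.run_code hexec hvars hcode.1 hrep
  refine ⟨t, σ, ?_, hrun, ?_, fun i => ?_, ?_, fun c => ?_⟩
  · have h1 : (t : ℝ) ≤ B * (((Nat.clog 2 (Nat.log 2 U + 1) : ℕ) + 2) * (⌊3 * τ⌋₊ + 1)) := by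
      rw [hlen] at ht
      exact_mod_cast ht
    have h2 := clog_log_le U
    have h3 := one_le_loglog U
    have h4 := one_le_loglog P.card
    have h5 : ((Nat.clog 2 (Nat.log 2 U + 1) : ℕ) : ℝ) + 2 ≤ 4 * loglog U := by linarith
    have h6 : (⌊3 * τ⌋₊ : ℝ) + 1 ≤ 4 * τ := by linarith
    calc (t : ℝ) ≤ B * (4 * loglog U * (4 * τ)) :=
          h1.trans (mul_le_mul_of_nonneg_left
            (mul_le_mul h5 h6 (by positivity) (by linarith)) (Nat.cast_nonneg B))
      -- The factor `1` is finally enlarged to `loglog P.card`.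
      _ = 16 * B * τ * loglog U * 1 := by ring
      _ ≤ (1000 + 16 * B) * τ * loglog U * loglog P.card := by
          gcongr
          linarith
  · show _ = _
    rw [hpc]
    exact hcode.2.1
  · rw [hσm]
    exact hM i
  · exact List.Nodup.of_map _ (by rw [hσ.out]; exact hnd)
  · rw [← tauDominates_toNat, ← List.mem_map_of_injective (f := BitVec.toNat)
      (fun x y h => BitVec.eq_of_toNat_eq h), hσ.out, hmem]
    rfl
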